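/- For a field $K$ let $\Gamma_K=\mathrm{Gal}(K^{\mathrm{sep}}/K)$ be its absolute Galois group, and for a finite group $G$ let $e(G)$ denote its exponent. Let $H$ be a finite group, let $A$ be a finite $H$-module, and let $F$ be a field containing a primitive root of unity of order $e(A)e(H)$. A class $\alpha\in H^2(H,A)$ is called negligible over $F$ if for every field extension $K/F$ and every continuous homomorphism $\rho\colon\Gamma_K\to H$ one has $\rho^*(\alpha)=0$ in $H^2(\Gamma_K,A)$, where $A$ is viewed as a discrete $\Gamma_K$-module via $\rho$; the negligible classes form a subgroup $H^2(H,A)_{\mathrm{neg},F}\subset H^2(H,A)$. For $a\in A$ let $H_a=\{h\in H : ha=a\}$ be the centralizer of $a$ in $H$, so that $a\in A^{H_a}=H^0(H_a,A)$. Then the subgroup $H^2(H,A)_{\mathrm{neg},F}$ is generated by the classes $$\mathrm{cor}_{H_a}^{H}(a\cup\chi),\qquad a\in A,\ \chi\in H^2(H_a,\mathbb Z),$$ where $a\cup\chi\in H^2(H_a,A)$ is the cup product and $\mathrm{cor}_{H_a}^{H}\colon H^2(H_a,A)\to H^2(H,A)$ is the corestriction. -/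

import Mathlib

/-!
Degree-two cohomology of a topological group `G` with coefficients in a discrete `G`-module `A`,
by inhomogeneous continuous cochains. A `G`-module is a `Representation ℤ G A`; a cochain that is
continuous for the discrete topology on `A` is a locally constant function. When `G` is discrete
every function is locally constant, and this is ordinary group cohomology.
-/

namespace NegligibleCohomology

section Cohomology

variable {G : Type*} [Group G] [TopologicalSpace G] {A : Type*} [AddCommGroup A]

/-- Continuous inhomogeneous 2-cocycles. -/
def Z2 (π : Representation ℤ G A) : AddSubgroup (G × G → A) where
  carrier := {f | IsLocallyConstant f ∧
    ∀ g h j : G, f (g * h, j) + f (g, h) = π g (f (h, j)) + f (g, h * j)}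
  zero_mem' := ⟨IsLocallyConstant.const 0, by simp⟩
  add_mem' := by
    rintro a b ⟨ha, ha'⟩ ⟨hb, hb'⟩
    refine ⟨ha.comp₂ hb (· + ·), fun g h j => ?_⟩
    have h1 := ha' g h j
    have h2 := hb' g h j
    simp only [Pi.add_apply, map_add]
    rw [add_add_add_comm, h1, h2, add_add_add_comm]
  neg_mem' := by
    rintro a ⟨ha, ha'⟩
    refine ⟨ha.comp Neg.neg, fun g h j => ?_⟩
    have h1 := ha' g h j
    simp only [Pi.neg_apply, map_neg]
    rw [← neg_add, h1, neg_add]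

/-- Inhomogeneous 2-coboundaries of continuous 1-cochains. -/
def B2 (π : Representation ℤ G A) : AddSubgroup (G × G → A) where
  carrier := {f | ∃ x : G → A, IsLocallyConstant x ∧
    ∀ g h : G, f (g, h) = π g (x h) - x (g * h) + x g}
  zero_mem' := ⟨0, IsLocallyConstant.const 0, by simp⟩
  add_mem' := by
    rintro a b ⟨x, hx, hx'⟩ ⟨y, hy, hy'⟩
    refine ⟨x + y, hx.comp₂ hy (· + ·), fun g h => ?_⟩
    simp only [Pi.add_apply, map_add, hx', hy']
    abel
  neg_mem' := by
    rintro a ⟨x, hx, hx'⟩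
    refine ⟨-x, hx.comp Neg.neg, fun g h => ?_⟩
    simp only [Pi.neg_apply, map_neg, hx']
    abel

/-- The second continuous cohomology group `H²(G, A)`. -/
abbrev H2 (π : Representation ℤ G A) : Type _ :=
  Z2 π ⧸ (B2 π).addSubgroupOf (Z2 π)

variable {G' : Type*} [Group G'] [TopologicalSpace G']

/-- The pullback `f ↦ f ∘ (ρ × ρ)` on cocycles, for a continuous homomorphism `ρ : G' → G`. -/
def pullbackZ2 (π : Representation ℤ G A) (ρ : G' →ₜ* G) :
    Z2 π →+ Z2 (π.comp (ρ : G' →* G)) where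
  toFun f := ⟨fun p => f.1 (ρ p.1, ρ p.2),
    IsLocallyConstant.comp_continuous (g := f.1) (f := fun p : G' × G' => (ρ p.1, ρ p.2)) f.2.1
      (((map_continuous ρ).comp continuous_fst).prodMk ((map_continuous ρ).comp continuous_snd)),
    fun g h j => by simpa using f.2.2 (ρ g) (ρ h) (ρ j)⟩
  map_zero' := rfl
  map_add' _ _ := rfl

/-- The homomorphism `ρ^* : H²(G, A) → H²(G', A)` induced by a continuous homomorphism
`ρ : G' → G`, where `G'` acts on `A` through `ρ`. -/
def pullback (π : Representation ℤ G A) (ρ : G' →ₜ* G) :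
    H2 π →+ H2 (π.comp (ρ : G' →* G)) :=
  QuotientAddGroup.map _ _ (pullbackZ2 π ρ) (by
    rintro f ⟨x, hx, hx'⟩
    refine ⟨fun g => x (ρ g), hx.comp_continuous (map_continuous ρ), fun g h => ?_⟩
    have h1 := hx' (ρ g) (ρ h)
    rw [← map_mul] at h1
    exact h1)

/-- The cup product of `a ∈ A^G = H⁰(G, A)` with an integral 2-cocycle, for the pairing
`A ⊗ ℤ = A`: it is given by `(a ∪ c)(g, h) = c(g, h) • a`. -/
def cupZ2 (π : Representation ℤ G A) (a : π.invariants) :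
    Z2 (Representation.trivial ℤ G ℤ) →+ Z2 π where
  toFun c := ⟨fun p => c.1 p • (a : A), c.2.1.comp (· • (a : A)), fun g h j => by
    have h1 := c.2.2 g h j
    have h2 : π g (a : A) = a := a.2 g
    simp only [Representation.trivial_apply] at h1
    rw [map_zsmul, h2, ← add_smul, ← add_smul, h1]⟩
  map_zero' := by ext p; simp
  map_add' c d := by ext p; simp [add_smul]

/-- The cup product `a ∪ - : H²(G, ℤ) → H²(G, A)` with `a ∈ A^G = H⁰(G, A)`. -/
def cup (π : Representation ℤ G A) (a : π.invariants) :
    H2 (Representation.trivial ℤ G ℤ) →+ H2 π :=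
  QuotientAddGroup.map _ _ (cupZ2 π a) (by
    rintro c ⟨x, hx, hx'⟩
    refine ⟨fun g => x g • (a : A), hx.comp (· • (a : A)), fun g h => ?_⟩
    have h2 : π g (a : A) = a := a.2 g
    have h1 := hx' g h
    simp only [Representation.trivial_apply] at h1
    change c.1 (g, h) • (a : A) = _
    rw [map_zsmul, h2, ← sub_smul, ← add_smul]
    exact congrArg (· • (a : A)) h1)

end Cohomology

section Corestriction

variable {G : Type*} [Group G] {A : Type*} [AddCommGroup A]

/-- With `t c ∈ G` the chosen representative of the coset `c ∈ G ⧸ S`, the element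
`t(c)⁻¹ g t(g⁻¹ c)` of `S`. -/
noncomputable def transferElt (S : Subgroup G) (c : G ⧸ S) (g : G) : S :=
  ⟨c.out⁻¹ * g * (g⁻¹ • c).out, by
    have h : ((g * (g⁻¹ • c).out : G) : G ⧸ S) = g • (((g⁻¹ • c).out : G) : G ⧸ S) := rfl
    rw [mul_assoc, ← QuotientGroup.eq, h, QuotientGroup.out_eq', QuotientGroup.out_eq',
      smul_inv_smul]⟩

lemma transferElt_mul (S : Subgroup G) (c : G ⧸ S) (g h : G) :
    transferElt S c (g * h) = transferElt S c g * transferElt S (g⁻¹ • c) h := by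
  ext
  simp [transferElt, mul_smul, mul_assoc]

lemma out_mul_transferElt (S : Subgroup G) (c : G ⧸ S) (g : G) :
    c.out * (transferElt S c g : G) = g * (g⁻¹ • c).out := by
  simp [transferElt, mul_assoc]

attribute [local instance] Subgroup.fintypeQuotientOfFiniteIndex

variable (S : Subgroup G) [S.FiniteIndex]

/-- Reindexing of a sum over the cosets by left translation. -/
lemma sum_smul_coset (g : G) (F : G ⧸ S → A) :
    ∑ c : G ⧸ S, F (g⁻¹ • c) = ∑ c : G ⧸ S, F c :=
  Equiv.sum_comp (MulAction.toPerm g⁻¹ : Equiv.Perm (G ⧸ S)) F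

variable [TopologicalSpace G] [DiscreteTopology G]

/-- Corestriction (transfer) of 2-cocycles from a subgroup `S` of finite index in a discrete
group `G`. With the representatives `t(c)` of the cosets `c ∈ G ⧸ S`, it is given by
`(cor f)(g, h) = ∑_c t(c) • f(t(c)⁻¹ g t(g⁻¹c), t(g⁻¹c)⁻¹ h t(h⁻¹g⁻¹c))`;
changing the representatives changes this by a coboundary. -/
noncomputable def corZ2 (π : Representation ℤ G A) : Z2 (π.comp S.subtype) →+ Z2 π where
  toFun f := ⟨fun p => ∑ c : G ⧸ S, π c.out
      (f.1 (transferElt S c p.1, transferElt S (p.1⁻¹ • c) p.2)),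
    IsLocallyConstant.of_discrete _, fun g h j => by
      have e : π g (∑ c : G ⧸ S, π c.out
          (f.1 (transferElt S c h, transferElt S (h⁻¹ • c) j))) =
          ∑ c : G ⧸ S, π c.out (π (transferElt S c g : G)
            (f.1 (transferElt S (g⁻¹ • c) h, transferElt S (h⁻¹ • g⁻¹ • c) j))) := by
        rw [← sum_smul_coset S g, map_sum]
        refine Finset.sum_congr rfl fun c _ => ?_
        simp only [← Module.End.mul_apply, ← map_mul, out_mul_transferElt]
      rw [e, ← Finset.sum_add_distrib, ← Finset.sum_add_distrib]
      refine Finset.sum_congr rfl fun c _ => ?_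
      have h1 := f.2.2 (transferElt S c g) (transferElt S (g⁻¹ • c) h)
        (transferElt S (h⁻¹ • g⁻¹ • c) j)
      rw [← map_add, ← map_add, mul_inv_rev, mul_smul, transferElt_mul, transferElt_mul]
      exact congrArg (π c.out) h1⟩
  map_zero' := by ext p; simp
  map_add' f f' := by ext p; simp [Finset.sum_add_distrib]

/-- The corestriction `cor : H²(S, A) → H²(G, A)`. -/
noncomputable def cor (π : Representation ℤ G A) : H2 (π.comp S.subtype) →+ H2 π :=
  QuotientAddGroup.map _ _ (corZ2 S π) (by
    rintro f ⟨x, hx, hx'⟩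
    refine ⟨fun g => ∑ c : G ⧸ S, π c.out (x (transferElt S c g)),
      IsLocallyConstant.of_discrete _, fun g h => ?_⟩
    have e : π g (∑ c : G ⧸ S, π c.out (x (transferElt S c h))) =
        ∑ c : G ⧸ S, π c.out (π (transferElt S c g : G) (x (transferElt S (g⁻¹ • c) h))) := by
      rw [← sum_smul_coset S g, map_sum]
      refine Finset.sum_congr rfl fun c _ => ?_
      simp only [← Module.End.mul_apply, ← map_mul, out_mul_transferElt]
    rw [e, ← Finset.sum_sub_distrib, ← Finset.sum_add_distrib]
    refine Finset.sum_congr rfl fun c _ => ?_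
    have h1 := hx' (transferElt S c g) (transferElt S (g⁻¹ • c) h)
    rw [← map_sub, ← map_add, transferElt_mul]
    exact congrArg (π c.out) h1)

end Corestriction

section Negligible

universe u

variable {H : Type*} [Group H] {A : Type*} [AddCommGroup A]

/-- The centralizer `H_a = {h ∈ H | h a = a}` of `a ∈ A`. -/
def centralizer (π : Representation ℤ H A) (a : A) : Subgroup H where
  carrier := {h | π h a = a}
  one_mem' := by simp
  mul_mem' := by
    intro g h hg hh
    change π (g * h) a = a
    rw [map_mul, Module.End.mul_apply, show π h a = a from hh, show π g a = a from hg]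
  inv_mem' := by
    intro g hg
    change π g⁻¹ a = a
    conv_lhs => rw [← show π g a = a from hg]
    exact π.inv_self_apply g a

/-- The element `a`, as an element of `A^{H_a}`. -/
def centralizedElt (π : Representation ℤ H A) (a : A) :
    Representation.invariants (π.comp (centralizer π a).subtype) :=
  ⟨a, fun h => h.2⟩

/-- The subgroup of classes `α ∈ H²(H, A)` negligible over `F`: for every field extension `K/F`
and every continuous homomorphism `ρ : Gal(K^sep/K) → H`, the class `ρ^* α` vanishes in
`H²(Gal(K^sep/K), A)`. -/
def negligible (F : Type u) [Field F] [TopologicalSpace H] (π : Representation ℤ H A) :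
    AddSubgroup (H2 π) where
  carrier := {α | ∀ (K : Type u) [Field K] [Algebra F K]
    (ρ : Gal(SeparableClosure K/K) →ₜ* H), pullback π ρ α = 0}
  zero_mem' := fun K _ _ ρ => map_zero _
  add_mem' := fun ha hb K _ _ ρ => by rw [map_add, ha K ρ, hb K ρ, add_zero]
  neg_mem' := fun ha K _ _ ρ => by rw [map_neg, ha K ρ, neg_zero]

end Negligible

end NegligibleCohomology

/-!
Let `n` and `m` be the exponents of `A` and `H`, and `ω` a primitive root of unity of order `n m`.

*The classes `cor (a ∪ χ)` are negligible.* Multiplied by `m`, the class `χ` is the coboundary of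
an integral cochain, so that it comes from a character of the centralizer of `a` of order dividing
`m` (`exists_mul_eq_coboundary`). Pulled back to an absolute Galois group and spread over the cosets
of the centralizer, this character becomes by Hilbert's theorem 90 for permutation modules
(`exists_twisted_family`) the character of the action on some elements of the separable closure. The
action on their `n`-th roots is given by roots of unity of order `n m`, and these lie in the base
field: the exponents lift the character modulo `m` to a cocycle modulo `n m`, and hence split the
pullback of `cor (a ∪ χ)`, as `n` kills `a` (`corZ2_cupZ2_eq_neg_coboundary`).

*Every negligible class is a sum of these.* Let `k` be an algebraic closure of `F`, let `H` permute
the variables of `R = k[X_h : h ∈ H]`, and let `K` be the fixed field of `H` in the field of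
fractions `L` of `R`. If the pullback of a cocycle `f` to the absolute Galois group of `K` is the
coboundary of `x`, then `x` restricts, up to a constant, to an `H`-equivariant homomorphism from the
absolute Galois group of `L` to `A`. By Kummer theory it corresponds to an invariant element of
`A ⊗ Lˣ`. The units of `R` are divisible and fixed by `H`, and `R` is factorial, so this is an
`H`-equivariant finitely supported function from the primes of `R` to `A`
(`FractionModel.sum_multiplicity_act`). The product `q a` of the primes with value `a` satisfies
`h (q a) = q (h a)` up to units (`FractionModel.exists_equivariant_kummer_family`). In particular
the centralizer of `a` acts on `q a` through a character; if `χ` is its Bockstein, the Kummer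
exponents of the translates of `q a` split the pullback of `-cor (a ∪ χ)`
(`FractionModel.exists_splitting_cor_cup`). Subtracting these splittings, for `a` in a set of
representatives of the `H`-orbits, from `x` gives a cochain which is constant on the absolute Galois
group of `L`, and therefore descends to `H` (`mem_B2_of_splitting`). Hence `f` plus the sum of the
classes `cor (a ∪ χ)` is a coboundary on `H`.
-/

/-! ### Hilbert's theorem 90 for permutation modules -/

namespace NegligibleCohomology

section Hilbert90

variable {K Ω : Type*} [Field K] [Field Ω] [Algebra K Ω] [IsGalois K Ω]
  {U Q C : Type*} [Group U] [Group Q] [Finite Q] [MulAction Q C]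

/-- The local form of `exists_twisted_family`: the solutions of the (additive) twisted equation
do not all vanish at a given point, by Artin's independence of characters. -/
lemma exists_twisted_family_ne_zero (j : U →* Gal(Ω/K)) (hj : Function.Injective j) (ρ : U →* Q)
    (hopen : IsOpen (ρ.ker.map j : Set Gal(Ω/K))) (b : Q → C → K) (hb0 : ∀ g c, b g c ≠ 0)
    (hb : ∀ g h c, b (g * h) c = b g c * b h (g⁻¹ • c)) (c₀ : C) :
    ∃ r : C → Ω, r c₀ ≠ 0 ∧
      ∀ τ c, j τ (r ((ρ τ)⁻¹ • c)) = algebraMap K Ω (b (ρ τ) c) * r c := by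
  classical
  let N' : ClosedSubgroup Gal(Ω/K) :=
    ⟨ρ.ker.map j, Subgroup.isClosed_of_isOpen _ hopen⟩
  let M : IntermediateField K Ω := IntermediateField.fixedField N'.1
  have hker : ∀ σ, ρ σ = 1 → ∀ y : M, j σ (y : Ω) = y := fun σ hσ y =>
    y.2 ⟨j σ, σ, hσ, rfl⟩
  have hagree : ∀ u u' : U, (∀ y : M, j u (y : Ω) = j u' (y : Ω)) → ρ u = ρ u' := by
    intro u u' h
    have h1 : j (u'⁻¹ * u) ∈ M.fixingSubgroup := by
      rw [IntermediateField.mem_fixingSubgroup_iff]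
      intro y hy
      have h2 : (j u'⁻¹) ((j u) y) = y := by
        rw [h ⟨y, hy⟩, ← AlgEquiv.mul_apply, ← map_mul, inv_mul_cancel, map_one]; rfl
      rw [map_mul]; exact h2
    rw [InfiniteGalois.fixingSubgroup_fixedField N'] at h1
    obtain ⟨v, hv, hv'⟩ := h1
    have : v = u'⁻¹ * u := hj hv'
    rw [this] at hv
    have h3 : ρ (u'⁻¹ * u) = 1 := hv
    rw [map_mul, map_inv, inv_mul_eq_one] at h3
    exact h3.symm
  choose lift hlift using fun q : ρ.range => q.2
  have hlift' : ∀ (σ : U) (q : ρ.range) (y : M),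
      j σ (j (lift q) (y : Ω)) = j (lift (⟨ρ σ, σ, rfl⟩ * q)) (y : Ω) := by
    intro σ q y
    have h1 := hker ((lift (⟨ρ σ, σ, rfl⟩ * q))⁻¹ * (σ * lift q))
      (by rw [map_mul, map_mul, map_inv, hlift, hlift]; simp) y
    rw [← AlgEquiv.mul_apply, ← map_mul]
    conv_rhs => rw [← h1, ← AlgEquiv.mul_apply, ← map_mul, mul_inv_cancel_left]
  let : Fintype ρ.range := Fintype.ofFinite _
  -- Distinct elements of the image of `ρ` restrict to distinct characters of the fixed field `M`.
  let ch : ρ.range → (M →* Ω) := fun q =>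
    ((j (lift q)).toAlgHom.toRingHom.comp (algebraMap M Ω) : M →+* Ω)
  have hch : ∀ q y, ch q y = j (lift q) (y : Ω) := fun _ _ => rfl
  have hchinj : Function.Injective ch := by
    intro q q' h
    have := hagree (lift q) (lift q') fun y => DFunLike.congr_fun h y
    rw [hlift, hlift] at this
    exact Subtype.ext this
  have hind := (linearIndependent_monoidHom M Ω).comp ch hchinj
  let coef : ρ.range → Ω := fun q =>
    if (q : Q)⁻¹ • c₀ = c₀ then (algebraMap K Ω (b q c₀))⁻¹ else 0
  obtain ⟨y₀, hy₀⟩ : ∃ y : M, ∑ q, coef q * ch q y ≠ 0 := by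
    by_contra! hcon
    have h1 := Fintype.linearIndependent_iff.1 hind coef (by
      ext y; simpa using hcon y) 1
    have h2 : coef 1 ≠ 0 := by
      simp only [coef]
      rw [if_pos (by simp)]
      exact inv_ne_zero ((map_ne_zero _).2 (hb0 _ _))
    exact h2 h1
  -- The solution is the Poincaré series of a function supported at `c₀`.
  let y : C → M := fun c => if c = c₀ then y₀ else 0
  refine ⟨fun c => ∑ q : ρ.range, (algebraMap K Ω (b q c))⁻¹ * j (lift q) (y ((q : Q)⁻¹ • c) : M),
    ?_, fun τ c => ?_⟩
  · refine ne_of_eq_of_ne (Finset.sum_congr rfl fun q _ => ?_) hy₀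
    simp only [coef, y, hch]
    split_ifs <;> simp
  · rw [map_sum, Finset.mul_sum]
    conv_rhs => rw [← Equiv.sum_comp (Equiv.mulLeft (⟨ρ τ, τ, rfl⟩ : ρ.range))]
    refine Finset.sum_congr rfl fun q _ => ?_
    rw [map_mul, map_inv₀, AlgEquiv.commutes, hlift']
    simp only [Equiv.coe_mulLeft, Subgroup.coe_mul, hb, mul_inv_rev, mul_smul, map_mul]
    have := (map_ne_zero (algebraMap K Ω)).2 (hb0 (ρ τ) c)
    field_simp

/-- Hilbert's theorem 90 for a permutation module: a multiplicative 1-cocycle of a finite group `Q`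
with values in the functions `C → Kˣ` on a `Q`-set `C` becomes, when pulled back to a group `U` of
automorphisms of `Ω` along a homomorphism `ρ : U → Q` with open kernel, the coboundary of a function
`C → Ωˣ`. For `C` a point this describes the characters of `U` with values in `Kˣ`. -/
theorem exists_twisted_family (j : U →* Gal(Ω/K)) (hj : Function.Injective j) (ρ : U →* Q)
    (hopen : IsOpen (ρ.ker.map j : Set Gal(Ω/K))) (b : Q → C → K) (hb0 : ∀ g c, b g c ≠ 0)
    (hb : ∀ g h c, b (g * h) c = b g c * b h (g⁻¹ • c)) :
    ∃ r : C → Ω, (∀ c, r c ≠ 0) ∧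
      ∀ τ c, j τ (r ((ρ τ)⁻¹ • c)) = algebraMap K Ω (b (ρ τ) c) * r c := by
  choose r hr0 hr using exists_twisted_family_ne_zero j hj ρ hopen b hb0 hb
  -- The equation only relates points of one orbit, and on each orbit the solution that does not
  -- vanish at the chosen base point is used. The orbits are those of the image of `ρ`.
  let base : C → C := fun c => (Quotient.mk (MulAction.orbitRel ρ.range C) c).out
  have hbase : ∀ τ c, base ((ρ τ)⁻¹ • c) = base c := fun τ c =>
    congrArg Quotient.out (Quotient.sound (s := MulAction.orbitRel ρ.range C)
      ⟨⟨(ρ τ)⁻¹, τ⁻¹, map_inv _ _⟩, rfl⟩)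
  refine ⟨fun c => r (base c) c, fun c hc => ?_, fun τ c => ?_⟩
  · obtain ⟨⟨_, τ, rfl⟩, hτ⟩ := Quotient.mk_out (s := MulAction.orbitRel ρ.range C) c
    change ρ τ • c = base c at hτ
    change r (base c) c = 0 at hc
    have h1 := hr (base c) τ (base c)
    rw [← hτ, inv_smul_smul, hτ, hc, map_zero] at h1
    exact mul_ne_zero ((map_ne_zero _).2 (hb0 _ _)) (hr0 _) h1.symm
  · simp only [hbase]
    exact hr _ _ _

end Hilbert90

/-! ### Splitting the pullback of a corestriction -/

section Splitting

attribute [local instance] Subgroup.fintypeQuotientOfFiniteIndex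

variable {H : Type*} [Group H] {A : Type*} [AddCommGroup A] (π : Representation ℤ H A)

/-- The translates of `a` are indexed by the cosets of its centralizer. -/
lemma apply_out_smul (a : A) (g : H) (c : H ⧸ centralizer π a) :
    π (g • c).out a = π g (π c.out a) := by
  have h1 : (g • c).out⁻¹ * (g * c.out) ∈ centralizer π a := by
    rw [← QuotientGroup.eq, QuotientGroup.out_eq']
    conv_lhs => rw [← QuotientGroup.out_eq' c]
    rfl
  have h2 : π ((g • c).out⁻¹ * (g * c.out)) a = a := h1
  refine (congrArg (π (g • c).out) h2).symm.trans ?_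
  rw [← Module.End.mul_apply, ← map_mul, mul_inv_cancel_left, map_mul, Module.End.mul_apply]

variable [Finite H]

/-- The cochain `τ ↦ ∑_c W(τ, c) • t(c) a` attached to a function `W` with values in the integral
permutation module on the cosets of the centralizer of `a`. -/
noncomputable def orbitCochain {Γ : Type*} (a : A) (W : Γ → H ⧸ centralizer π a → ℤ) (τ : Γ) : A :=
  ∑ c, W τ c • π c.out a

/-- If `m χ = δV` on the centralizer of `a` and the function `V(t(c)⁻¹ g t(g⁻¹c)) + m W(g, c)` is
modulo `n m` a 1-cocycle of `Γ` with values in the permutation module on the cosets, then, as `a`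
is killed by `n`, the cochain attached to `W` splits the pullback of `cor (a ∪ χ)`, up to sign. -/
lemma corZ2_cupZ2_eq_neg_coboundary [TopologicalSpace H] [DiscreteTopology H]
    {Γ : Type*} [Group Γ] (ρ : Γ →* H) (a : A) {n m : ℕ}
    (hm : m ≠ 0) (hn : n • a = 0)
    (χ : Z2 (Representation.trivial ℤ (centralizer π a) ℤ)) (V : centralizer π a → ℤ)
    (hV : ∀ g h, m * χ.1 (g, h) = V h - V (g * h) + V g)
    (W : Γ → H ⧸ centralizer π a → ℤ)
    (hW : ∀ σ τ c, ((n * m : ℕ) : ℤ) ∣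
      (V (transferElt _ c (ρ σ)) + m * W σ c) +
        (V (transferElt _ ((ρ σ)⁻¹ • c) (ρ τ)) + m * W τ ((ρ σ)⁻¹ • c)) -
        (V (transferElt _ c (ρ (σ * τ))) + m * W (σ * τ) c)) (σ τ : Γ) :
    (corZ2 (centralizer π a) π (cupZ2 _ (centralizedElt π a) χ)).1 (ρ σ, ρ τ) =
      -(π (ρ σ) (orbitCochain π a W τ) - orbitCochain π a W (σ * τ) + orbitCochain π a W σ) := by
  have e : π (ρ σ) (orbitCochain π a W τ) = ∑ c, W τ ((ρ σ)⁻¹ • c) • π c.out a := by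
    rw [orbitCochain, ← sum_smul_coset _ (ρ σ), map_sum]
    refine Finset.sum_congr rfl fun c _ => ?_
    rw [map_zsmul, ← apply_out_smul, smul_inv_smul]
  have e2 : (corZ2 (centralizer π a) π (cupZ2 _ (centralizedElt π a) χ)).1 (ρ σ, ρ τ) =
      ∑ c, χ.1 (transferElt _ c (ρ σ), transferElt _ ((ρ σ)⁻¹ • c) (ρ τ)) • π c.out a := by
    refine Finset.sum_congr rfl fun c _ => ?_
    rw [← map_zsmul]; rfl
  rw [e, e2, eq_neg_iff_add_eq_zero, orbitCochain, orbitCochain, ← Finset.sum_sub_distrib,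
    ← Finset.sum_add_distrib, ← Finset.sum_add_distrib]
  refine Finset.sum_eq_zero fun c _ => ?_
  rw [← sub_smul, ← add_smul, ← add_smul]
  obtain ⟨d, hd⟩ := hW σ τ c
  have h1 := hV (transferElt _ c (ρ σ)) (transferElt _ ((ρ σ)⁻¹ • c) (ρ τ))
  rw [← transferElt_mul, ← map_mul] at h1
  have h2 : χ.1 (transferElt _ c (ρ σ), transferElt _ ((ρ σ)⁻¹ • c) (ρ τ)) +
      (W τ ((ρ σ)⁻¹ • c) - W (σ * τ) c + W σ c) = d * n := by
    have hm' : (m : ℤ) ≠ 0 := by exact_mod_cast hm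
    refine mul_left_cancel₀ hm' ?_
    push_cast at hd
    linear_combination h1 + hd
  rw [h2, mul_smul, natCast_zsmul, ← map_nsmul, hn, map_zero, smul_zero]

end Splitting

section Kummer

variable {K Ω : Type*} [Field K] [Field Ω] [Algebra K Ω]

/-- The exponents of a twisted family of nonzero elements form a cocycle. -/
lemma dvd_exponent_cocycle {H C : Type*} [Group H] [MulAction H C] (ρ : Gal(Ω/K) →* H) {N : ℕ}
    (hN : N ≠ 0) {ω : K} (hω : IsPrimitiveRoot ω N) (s : C → Ω) (hs0 : ∀ c, s c ≠ 0)
    (B : Gal(Ω/K) → C → ℤ) (hs : ∀ τ c, τ (s ((ρ τ)⁻¹ • c)) = algebraMap K Ω (ω ^ B τ c) * s c)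
    (σ τ : Gal(Ω/K)) (c : C) :
    (N : ℤ) ∣ B σ c + B τ ((ρ σ)⁻¹ • c) - B (σ * τ) c := by
  rw [← hω.zpow_eq_one_iff_dvd]
  have hω0 : ω ≠ 0 := hω.ne_zero hN
  have h1 := hs (σ * τ) c
  rw [map_mul, mul_inv_rev, mul_smul, AlgEquiv.mul_apply, hs τ, map_mul, AlgEquiv.commutes, hs σ,
    ← mul_assoc] at h1
  have h2 := mul_right_cancel₀ (hs0 c) h1
  rw [← map_mul] at h2
  have h3 := (algebraMap K Ω).injective h2
  rw [zpow_sub₀ hω0, zpow_add₀ hω0, mul_comm (ω ^ _), h3, div_self (zpow_ne_zero _ hω0)]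

/-- If the `n`-th powers of `x` and `y` differ by the factor `ω ^ (n V)`, for a primitive root of
unity `ω` of order `n m`, then `x` and `y` differ by a factor `ω ^ (V + m W)`. -/
lemma exists_eq_pow_mul_of_pow_eq {n m : ℕ} (hn : n ≠ 0) (hm : m ≠ 0) {ω : K}
    (hω : IsPrimitiveRoot ω (n * m)) {x y : Ω} (hy : y ≠ 0) (V : ℤ)
    (h : x ^ n = algebraMap K Ω (ω ^ (n * V)) * y ^ n) :
    ∃ W : ℤ, x = algebraMap K Ω (ω ^ (V + m * W)) * y := by
  have hω0 : ω ≠ 0 := hω.ne_zero (mul_ne_zero hn hm)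
  have : NeZero n := ⟨hn⟩
  have hζ : IsPrimitiveRoot (algebraMap K Ω ω ^ m) n :=
    (hω.map_of_injective (algebraMap K Ω).injective).pow
      (Nat.pos_of_ne_zero (mul_ne_zero hn hm)) (mul_comm _ _)
  have hω' : algebraMap K Ω ω ≠ 0 := (map_ne_zero _).2 hω0
  have h1 : (x / (algebraMap K Ω ω ^ V * y)) ^ n = 1 := by
    rw [div_pow, h, mul_pow, map_zpow₀, ← zpow_natCast (_ ^ V), ← zpow_mul, mul_comm V]
    exact div_self (mul_ne_zero (zpow_ne_zero _ hω') (pow_ne_zero _ hy))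
  obtain ⟨i, -, hi⟩ := hζ.eq_pow_of_pow_eq_one h1
  refine ⟨i, ?_⟩
  rw [eq_div_iff (mul_ne_zero (zpow_ne_zero _ hω') hy)] at hi
  rw [← hi, map_zpow₀, zpow_add₀ hω', zpow_mul, zpow_natCast, zpow_natCast]
  ring

end Kummer

/-! ### Corestrictions of cup products are negligible -/

section Bockstein

variable {S : Type*} [Group S] [Finite S] [TopologicalSpace S]

/-- An integral 2-cocycle of a finite group becomes a coboundary after multiplication by any
multiple `m` of the exponent: it is the Bockstein of a character with values in `(1/m)ℤ/ℤ`. -/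
lemma exists_mul_eq_coboundary {m : ℕ} (hm : ∀ g : S, g ^ m = 1)
    (χ : Z2 (Representation.trivial ℤ S ℤ)) :
    ∃ V : S → ℤ, ∀ g h, m * χ.1 (g, h) = V h - V (g * h) + V g := by
  have := Fintype.ofFinite S
  -- Summing the cocycle relation gives `|S| χ = δv`. So `v` is additive modulo `|S|`, hence
  -- `m v` is divisible by `|S|`, and the quotient is the cochain sought.
  let v : S → ℤ := fun g => ∑ j, χ.1 (g, j)
  have hv : ∀ g h, Fintype.card S * χ.1 (g, h) = v h - v (g * h) + v g := by
    intro g h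
    have h1 : ∑ j, (χ.1 (g * h, j) + χ.1 (g, h)) = ∑ j, (χ.1 (h, j) + χ.1 (g, h * j)) :=
      Finset.sum_congr rfl fun j _ => χ.2.2 g h j
    rw [Finset.sum_add_distrib, Finset.sum_add_distrib,
      show ∑ j, χ.1 (g, h * j) = v g from
        Equiv.sum_comp (Equiv.mulLeft h) (fun j => χ.1 (g, j))] at h1
    simp only [Finset.sum_const, Finset.card_univ, nsmul_eq_mul] at h1
    change v (g * h) + _ = v h + v g at h1
    linear_combination h1
  have hv1 : (Fintype.card S : ℤ) ∣ v 1 := ⟨χ.1 (1, 1), by rw [hv]; simp⟩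
  have hpow : ∀ g (i : ℕ), (Fintype.card S : ℤ) ∣ v (g ^ i) - i * v g := by
    intro g i
    induction i with
    | zero => simpa using hv1
    | succ i ih =>
      have h2 : (Fintype.card S : ℤ) ∣ v g - v (g ^ i * g) + v (g ^ i) := ⟨_, (hv _ _).symm⟩
      have e : v (g ^ (i + 1)) - ((i + 1 : ℕ) : ℤ) * v g =
          v (g ^ i) - i * v g - (v g - v (g ^ i * g) + v (g ^ i)) := by
        rw [pow_succ]
        push_cast
        ring
      rw [e]
      exact dvd_sub ih h2
  have hdvd : ∀ g, (Fintype.card S : ℤ) ∣ m * v g := by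
    intro g
    have h1 := hpow g m
    rw [hm] at h1
    exact (dvd_sub_right hv1).1 h1
  choose V hV using hdvd
  refine ⟨V, fun g h => ?_⟩
  have h0 : (Fintype.card S : ℤ) ≠ 0 := by exact_mod_cast Fintype.card_ne_zero
  refine mul_left_cancel₀ h0 ?_
  linear_combination (m : ℤ) * hv g h + hV h - hV (g * h) + hV g

end Bockstein

section Negligible

lemma transferElt_one {H : Type*} [Group H] (S : Subgroup H) (c : H ⧸ S) :
    transferElt S c 1 = 1 := by
  have h1 := transferElt_mul S c 1 1
  rw [mul_one, inv_one, one_smul] at h1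
  exact (left_eq_mul.1 h1)

variable {H : Type*} [Group H] [Finite H] [TopologicalSpace H] [DiscreteTopology H]
  {A : Type*} [AddCommGroup A] (π : Representation ℤ H A)

/-- A map to the Galois translates of finitely many elements is locally constant. -/
lemma isLocallyConstant_galois_apply {K Ω C : Type*} [Field K] [Field Ω] [Algebra K Ω]
    [Algebra.IsIntegral K Ω] [Finite C] (s : C → Ω) :
    IsLocallyConstant fun (τ : Gal(Ω/K)) (c : C) => τ (s c) := by
  rw [IsLocallyConstant.iff_eventually_eq]
  intro τ
  have h1 : ∀ c, ∀ᶠ τ' in nhds τ, τ' (s c) = τ (s c) := by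
    intro c
    have hopen := stabilizer_isOpen_of_isIntegral (K := K) (s c)
    have hcont : Continuous fun τ' : Gal(Ω/K) => τ⁻¹ * τ' := continuous_const_mul _
    have h2 := (hopen.preimage hcont).mem_nhds (x := τ) (by simp)
    filter_upwards [h2] with τ' hτ'
    have h3 : (τ⁻¹ * τ') (s c) = s c := hτ'
    rw [AlgEquiv.mul_apply] at h3
    conv_rhs => rw [← h3, ← AlgEquiv.mul_apply, mul_inv_cancel]
    rfl
  filter_upwards [Filter.eventually_all.2 h1] with τ' hτ'
  funext c
  exact hτ' c

/-- The corestrictions of the cup products `a ∪ χ` are negligible. By Hilbert's theorem 90 the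
character attached to `χ` becomes, over every extension, a Kummer character; the roots of unity of
order `e(A) e(H)` then allow to divide it by the order of `a`. -/
theorem cor_cup_mem_negligible {F : Type*} [Field F] {n m : ℕ} (hn : ∀ a : A, n • a = 0)
    (hm : ∀ h : H, h ^ m = 1) (hn0 : n ≠ 0) (hm0 : m ≠ 0) {ω : F}
    (hω : IsPrimitiveRoot ω (n * m)) (a : A)
    (χ : H2 (Representation.trivial ℤ (centralizer π a) ℤ)) :
    cor (centralizer π a) π (cup _ (centralizedElt π a) χ) ∈ negligible F π := by
  intro K _ _ ρ
  obtain ⟨χ, rfl⟩ := QuotientAddGroup.mk_surjective χ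
  obtain ⟨V, hV⟩ := exists_mul_eq_coboundary (m := m)
    (fun g => Subtype.ext (by simpa using hm g)) χ
  let Ω := SeparableClosure K
  let ωK : K := algebraMap F K ω
  have hωK : IsPrimitiveRoot ωK (n * m) := hω.map_of_injective (algebraMap F K).injective
  have hωK0 : ωK ≠ 0 := hωK.ne_zero (mul_ne_zero hn0 hm0)
  have : NeZero (n * m) := ⟨mul_ne_zero hn0 hm0⟩
  have : NeZero ((n * m : ℕ) : K) := hωK.neZero'
  have : NeZero (n : Ω) := ⟨fun h => NeZero.ne ((n * m : ℕ) : K) (by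
    have h1 : algebraMap K Ω n = 0 := by simpa using h
    rw [map_eq_zero] at h1
    rw [Nat.cast_mul, h1, zero_mul])⟩
  let b : H → H ⧸ centralizer π a → K := fun g c => ωK ^ (n * V (transferElt _ c g))
  have hρ : Continuous ρ := ρ.continuous_toFun
  obtain ⟨r, hr0, hr⟩ := exists_twisted_family (K := K) (Ω := Ω) (MonoidHom.id Gal(Ω/K))
    Function.injective_id (ρ : Gal(Ω/K) →* H)
    (by
      rw [Subgroup.map_id]
      exact (isOpen_discrete {(1 : H)}).preimage hρ)
    b (fun g c => zpow_ne_zero _ hωK0) (fun g h c => by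
      obtain ⟨d, hd⟩ : ∃ d, V (transferElt _ c (g * h)) =
          V (transferElt _ c g) + V (transferElt _ (g⁻¹ • c) h) + m * d := by
        have h1 := hV (transferElt _ c g) (transferElt _ (g⁻¹ • c) h)
        rw [← transferElt_mul] at h1
        exact ⟨-χ.1 (transferElt _ c g, transferElt _ (g⁻¹ • c) h), by linear_combination h1⟩
      simp only [b]
      rw [hd, ← zpow_add₀ hωK0, ← mul_add, mul_add _ _ (m * d), zpow_add₀ hωK0, ← mul_assoc,
        ← Nat.cast_mul, zpow_mul _ ((n * m : ℕ) : ℤ), zpow_natCast, hωK.pow_eq_one, one_zpow,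
        mul_one])
  choose s hs using fun c => IsSepClosed.exists_pow_nat_eq (r c) n
  have hs0 : ∀ c, s c ≠ 0 := fun c h => hr0 c (by rw [← hs, h, zero_pow hn0])
  -- The exponent is chosen as a function of `ρ τ` and of the values `τ (s c)` only.
  have hex : ∀ (g : H) (t : H ⧸ centralizer π a → Ω) (c : H ⧸ centralizer π a), ∃ W : ℤ,
      t (g⁻¹ • c) ^ n = algebraMap K Ω (ωK ^ (n * V (transferElt _ c g))) * s c ^ n →
      t (g⁻¹ • c) = algebraMap K Ω (ωK ^ (V (transferElt _ c g) + m * W)) * s c := by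
    intro g t c
    by_cases h : t (g⁻¹ • c) ^ n = algebraMap K Ω (ωK ^ (n * V (transferElt _ c g))) * s c ^ n
    · obtain ⟨W, hW⟩ := exists_eq_pow_mul_of_pow_eq hn0 hm0 hωK (hs0 c) _ h
      exact ⟨W, fun _ => hW⟩
    · exact ⟨0, fun h' => absurd h' h⟩
  choose W hW using hex
  let W' : Gal(Ω/K) → H ⧸ centralizer π a → ℤ := fun τ c => W (ρ τ) (fun c => τ (s c)) c
  have hW' : ∀ (τ : Gal(Ω/K)) c, τ (s ((ρ τ)⁻¹ • c)) =
      algebraMap K Ω (ωK ^ (V (transferElt _ c (ρ τ)) + m * W' τ c)) * s c := by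
    intro τ c
    refine hW (ρ τ) (fun c => τ (s c)) c ?_
    rw [hs, ← map_pow, hs]
    exact hr τ c
  have key := corZ2_cupZ2_eq_neg_coboundary π (ρ : Gal(Ω/K) →* H) a hm0 (hn a) χ V hV W'
    (dvd_exponent_cocycle (ρ : Gal(Ω/K) →* H) (mul_ne_zero hn0 hm0) hωK s hs0
      (fun τ c => V (transferElt _ c (ρ τ)) + m * W' τ c) hW')
  refine (QuotientAddGroup.eq_zero_iff _).2 ⟨-orbitCochain π a W', ?_, fun σ τ => ?_⟩
  · have h1 : IsLocallyConstant fun τ : Gal(Ω/K) => (ρ τ, fun c => τ (s c)) :=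
      ((IsLocallyConstant.of_discrete (id : H → H)).comp_continuous hρ).prodMk
        (isLocallyConstant_galois_apply s)
    exact h1.comp fun p : H × _ => -orbitCochain π a (fun _ : Unit => W p.1 p.2) ()
  · refine (key σ τ).trans ?_
    simp only [Pi.neg_apply, map_neg]
    change -(π (ρ σ) _ - _ + _) = -π (ρ σ) _ - _ + _
    abel

end Negligible

/-! ### Kummer theory over a field of fractions -/

section Kummer

variable {K Ω : Type*} [Field K] [Field Ω] [Algebra K Ω] {H : Type*} [Group H]

/-- The integers `k σ` are Kummer exponents of `s` on the kernel of `ρ`: for `σ` in this kernel,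
`σ s = ζ ^ k σ * s`. Values of `k` off the kernel are irrelevant. -/
def IsKummerExponent (ρ : Gal(Ω/K) →* H) (ζ : K) (s : Ω) (k : Gal(Ω/K) → ℤ) : Prop :=
  ∀ σ, ρ σ = 1 → σ s = algebraMap K Ω ζ ^ k σ * s

namespace IsKummerExponent

variable {ρ : Gal(Ω/K) →* H} {ζ : K} {s t : Ω} {k l : Gal(Ω/K) → ℤ}

lemma pow (hs : IsKummerExponent ρ ζ s k) (i : ℕ) :
    IsKummerExponent ρ ζ (s ^ i) (fun σ => i * k σ) := fun σ hσ => by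
  change _ = _ ^ (i * k σ) * _
  rw [map_pow, hs σ hσ, mul_pow, mul_comm (i : ℤ), zpow_mul, zpow_natCast]

lemma prod (hζ : ζ ≠ 0) {J : Type*} (D : Finset J) {s : J → Ω} {k : J → Gal(Ω/K) → ℤ}
    (hs : ∀ j ∈ D, IsKummerExponent ρ ζ (s j) (k j)) :
    IsKummerExponent ρ ζ (∏ j ∈ D, s j) (fun σ => ∑ j ∈ D, k j σ) := fun σ hσ => by
  classical
  induction D using Finset.induction_on with
  | empty => simp
  | insert j D hj ih =>
    change _ = _ ^ (∑ j ∈ insert j D, k j σ) * _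
    rw [Finset.prod_insert hj, Finset.sum_insert hj, map_mul,
      hs j (Finset.mem_insert_self _ _) σ hσ, ih fun i hi => hs i (Finset.mem_insert_of_mem hi),
      zpow_add₀ ((map_ne_zero _).2 hζ)]
    ring

lemma conj (hs : IsKummerExponent ρ ζ s k) (τ : Gal(Ω/K)) :
    IsKummerExponent ρ ζ (τ⁻¹ s) (fun σ => k (τ * σ * τ⁻¹)) := fun σ hσ => by
  have h1 := congrArg (τ⁻¹ : Gal(Ω/K)) (hs (τ * σ * τ⁻¹) (by simp [hσ]))
  rw [map_mul, map_zpow₀, AlgEquiv.commutes, ← AlgEquiv.mul_apply] at h1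
  rw [← h1, ← AlgEquiv.mul_apply]
  congr 1
  group

variable {n : ℕ} (hζ : IsPrimitiveRoot ζ n) (hn : n ≠ 0)

include hζ hn

lemma dvd_sub (hs0 : s ≠ 0) (hs : IsKummerExponent ρ ζ s k) (hs' : IsKummerExponent ρ ζ s l)
    {σ : Gal(Ω/K)} (hσ : ρ σ = 1) : (n : ℤ) ∣ k σ - l σ := by
  have hζ0 : algebraMap K Ω ζ ≠ 0 := (map_ne_zero _).2 (hζ.ne_zero hn)
  rw [← (hζ.map_of_injective (algebraMap K Ω).injective).zpow_eq_one_iff_dvd, zpow_sub₀ hζ0,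
    ← mul_right_cancel₀ hs0 ((hs σ hσ).symm.trans (hs' σ hσ)), div_self (zpow_ne_zero _ hζ0)]

lemma exists_of_pow_fixed (hs0 : s ≠ 0) (h : ∀ σ, ρ σ = 1 → σ (s ^ n) = s ^ n) :
    ∃ k, IsKummerExponent ρ ζ s k := by
  have : NeZero n := ⟨hn⟩
  have h1 : ∀ σ, ∃ k : ℤ, ρ σ = 1 → σ s = algebraMap K Ω ζ ^ k * s := by
    intro σ
    by_cases hσ : ρ σ = 1
    · have h2 : (σ s / s) ^ n = 1 := by
        rw [div_pow, ← map_pow, h σ hσ, div_self (pow_ne_zero _ hs0)]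
      obtain ⟨i, -, hi⟩ :=
        (hζ.map_of_injective (algebraMap K Ω).injective).eq_pow_of_pow_eq_one h2
      exact ⟨i, fun _ => by rw [zpow_natCast, hi, div_mul_cancel₀ _ hs0]⟩
    · exact ⟨0, fun h => absurd h hσ⟩
  choose k hk using h1
  exact ⟨k, hk⟩

/-- Kummer exponents only depend on the `n`-th power, up to `n`-th powers of fixed elements. -/
lemma of_pow_eq {c : Ω} (hc0 : c ≠ 0) (hc : ∀ σ, ρ σ = 1 → σ c = c) (ht0 : t ≠ 0)
    (ht : IsKummerExponent ρ ζ t k) (h : s ^ n = c ^ n * t ^ n) :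
    IsKummerExponent ρ ζ s k := fun σ hσ => by
  have : NeZero n := ⟨hn⟩
  have h2 : (s / (c * t)) ^ n = 1 := by
    rw [div_pow, h, mul_pow, div_self (mul_ne_zero (pow_ne_zero _ hc0) (pow_ne_zero _ ht0))]
  obtain ⟨i, -, hi⟩ := (hζ.map_of_injective (algebraMap K Ω).injective).eq_pow_of_pow_eq_one h2
  rw [eq_div_iff (mul_ne_zero hc0 ht0)] at hi
  rw [← hi, map_mul, map_mul, map_pow, AlgEquiv.commutes, hc σ hσ, ht σ hσ]
  ring

end IsKummerExponent

/-- A ring `R` with an action of `H`, embedded equivariantly in `Ω`, such that the units of `R` are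
fixed by `H` and divisible, and the elements of `Ω` fixed by the kernel of `ρ : Gal(Ω/K) → H` are
fractions of elements of `R`. If `R` is factorial, then the multiplicative group of its field of
fractions is, modulo divisible elements fixed by `H`, a permutation module. -/
structure FractionModel (ρ : Gal(Ω/K) →* H) (R : Type*) [CommRing R] where
  /-- The action of `H` on `R`. -/
  act : H →* (R ≃+* R)
  /-- The embedding of `R` in `Ω`. -/
  emb : R →+* Ω
  emb_injective : Function.Injective emb
  equivariant : ∀ τ r, τ (emb r) = emb (act (ρ τ) r)
  unit_fixed : ∀ h (u : Rˣ), act h u = u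
  exists_unit_root : ∀ (u : Rˣ) (n : ℕ), n ≠ 0 → ∃ v : Rˣ, v ^ n = u
  exists_fraction : ∀ e : Ω, (∀ σ, ρ σ = 1 → σ e = e) →
    ∃ r r' : R, r' ≠ 0 ∧ e * emb r' = emb r

namespace FractionModel

variable {ρ : Gal(Ω/K) →* H} {R : Type*} [CommRing R] (M : FractionModel ρ R)

lemma emb_ne_zero {r : R} (hr : r ≠ 0) : M.emb r ≠ 0 :=
  (map_ne_zero_iff _ M.emb_injective).2 hr

lemma apply_emb_of_eq_one {σ : Gal(Ω/K)} (hσ : ρ σ = 1) (r : R) : σ (M.emb r) = M.emb r := by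
  rw [M.equivariant, hσ, map_one]
  rfl

lemma isKummerExponent_of_associated [Nontrivial R] {n : ℕ} {ζ : K} (hζ : IsPrimitiveRoot ζ n)
    (hn : n ≠ 0) {s t : Ω} (ht0 : t ≠ 0) {k : Gal(Ω/K) → ℤ} (ht : IsKummerExponent ρ ζ t k)
    {l l' : R} (h : Associated l' l) (hs : s ^ n = M.emb l) (ht' : t ^ n = M.emb l') :
    IsKummerExponent ρ ζ s k := by
  obtain ⟨u, rfl⟩ := h
  obtain ⟨v, rfl⟩ := M.exists_unit_root u n hn
  refine IsKummerExponent.of_pow_eq hζ hn (M.emb_ne_zero v.ne_zero)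
    (fun σ hσ => M.apply_emb_of_eq_one hσ v) ht0 ht ?_
  rw [hs, ht', map_mul, Units.val_pow_eq_pow_val, map_pow, mul_comm]

lemma exists_isKummerExponent [IsSepClosed Ω] {n : ℕ} {ζ : K} (hζ : IsPrimitiveRoot ζ n)
    (hn : n ≠ 0) {l : R} (hl : l ≠ 0) :
    ∃ s k, s ≠ 0 ∧ s ^ n = M.emb l ∧ IsKummerExponent ρ ζ s k := by
  have : NeZero n := ⟨hn⟩
  have : NeZero (n : Ω) := (hζ.map_of_injective (algebraMap K Ω).injective).neZero'
  obtain ⟨s, hs⟩ := IsSepClosed.exists_pow_nat_eq (M.emb l) n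
  have hs0 : s ≠ 0 := by
    rintro rfl
    rw [zero_pow hn] at hs
    exact M.emb_ne_zero hl hs.symm
  obtain ⟨k, hk⟩ := IsKummerExponent.exists_of_pow_fixed (ρ := ρ) hζ hn hs0 (fun σ hσ => by
    rw [hs, M.apply_emb_of_eq_one hσ])
  exact ⟨s, k, hs0, hs, hk⟩

end FractionModel

end Kummer

section Decomposition

/-- A finite abelian group killed by `n` is a direct sum of cyclic groups of orders dividing `n`,
in terms of generators and coordinates. -/
lemma exists_generators_coordinates {A : Type*} [AddCommGroup A] [Finite A] {n : ℕ}
    (hn : ∀ a : A, n • a = 0) :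
    ∃ (J : Type) (_ : Fintype J) (d : J → ℕ) (b : J → A) (x : ∀ j, A →+ ZMod (d j)),
      (∀ j, d j ≠ 0 ∧ d j ∣ n ∧ d j • b j = 0) ∧ ∀ a, a = ∑ j, (x j a).val • b j := by
  classical
  obtain ⟨J, hJ, d, hd, ⟨e⟩⟩ := AddCommGroup.equiv_directSum_zmod_of_finite' A
  have hd' : ∀ j, NeZero (d j) := fun j => ⟨(zero_lt_one.trans (hd j)).ne'⟩
  refine ⟨J, hJ, d, fun j => e.symm (DirectSum.of _ j 1),
    fun j => (DFinsupp.evalAddMonoidHom j).comp e.toAddMonoidHom, fun j => ⟨(hd' j).out, ?_, ?_⟩,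
    fun a => ?_⟩
  · have h1 := congrArg e (hn (e.symm (DirectSum.of _ j 1)))
    rw [map_nsmul, e.apply_symm_apply, map_zero, ← map_nsmul] at h1
    have h2 := DirectSum.of_injective (β := fun j => ZMod (d j)) j (h1.trans (map_zero _).symm)
    rw [nsmul_one] at h2
    exact (ZMod.natCast_eq_zero_iff _ _).1 h2
  · rw [← map_nsmul, ← map_nsmul, nsmul_one, ZMod.natCast_self, map_zero, map_zero]
  · apply e.injective
    rw [map_sum]
    conv_lhs => rw [← DirectSum.sum_univ_of (e a)]
    refine Finset.sum_congr rfl fun j _ => ?_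
    rw [map_nsmul, e.apply_symm_apply, ← map_nsmul, nsmul_one, ZMod.natCast_val, ZMod.cast_id]
    rfl

end Decomposition

namespace FractionModel

variable {K Ω : Type*} [Field K] [Field Ω] [Algebra K Ω] {H : Type*} [Group H]
  {ρ : Gal(Ω/K) →* H} {R : Type*} [CommRing R] (M : FractionModel ρ R)

/-- Kummer theory: on the kernel of `ρ`, every character of order dividing `d ∣ n` is the
reduction of the Kummer exponent of an `n`-th root of some element of `R`. -/
lemma exists_kummer_lift [IsGalois K Ω] [IsSepClosed Ω] [IsDomain R] {n d : ℕ} {ζ : K}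
    (hζ : IsPrimitiveRoot ζ n) (hn : n ≠ 0) (hd : d ∣ n) (hρ : IsOpen (ρ.ker : Set Gal(Ω/K)))
    {z : Gal(Ω/K) → ZMod d} (hz : IsLocallyConstant z)
    (hadd : ∀ σ τ, ρ σ = 1 → ρ τ = 1 → z (σ * τ) = z σ + z τ) :
    ∃ s l k, s ≠ 0 ∧ l ≠ 0 ∧ s ^ n = M.emb l ∧ IsKummerExponent ρ ζ s k ∧
      ∀ σ, ρ σ = 1 → (k σ : ZMod d) = z σ := by
  have hd0 : d ≠ 0 := by rintro rfl; exact hn (zero_dvd_iff.1 hd)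
  obtain ⟨e, rfl⟩ := hd
  have he0 : e ≠ 0 := by rintro rfl; exact hn (mul_zero _)
  have : NeZero d := ⟨hd0⟩
  have : NeZero (d * e) := ⟨hn⟩
  have hζΩ : IsPrimitiveRoot (algebraMap K Ω ζ) (d * e) :=
    hζ.map_of_injective (algebraMap K Ω).injective
  have hne : NeZero ((d * e : ℕ) : Ω) := hζΩ.neZero'
  have : NeZero (e : Ω) := ⟨fun h => hne.out (by rw [Nat.cast_mul, h, mul_zero])⟩
  have hη : IsPrimitiveRoot (ζ ^ e) d := hζ.pow (Nat.pos_of_ne_zero hn) (mul_comm _ _)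
  have hη0 : ζ ^ e ≠ 0 := hη.ne_zero hd0
  let ρ' : ρ.ker →* Multiplicative (ZMod d) := MonoidHom.mk' (fun σ => Multiplicative.ofAdd (z σ))
    fun σ τ => congrArg Multiplicative.ofAdd (hadd σ τ σ.2 τ.2)
  have hopen : IsOpen (ρ'.ker.map ρ.ker.subtype : Set Gal(Ω/K)) := by
    convert hρ.inter (hz.isOpen_fiber 0) using 1
    ext σ
    constructor
    · rintro ⟨σ, hσ, rfl⟩
      exact ⟨σ.2, hσ⟩
    · rintro ⟨h1, h2⟩
      exact ⟨⟨σ, h1⟩, h2, rfl⟩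
  obtain ⟨r, hr0, hr⟩ := exists_twisted_family (K := K) (Ω := Ω) (C := Unit) ρ.ker.subtype
    ρ.ker.subtype_injective ρ' hopen
    (fun g _ => (ζ ^ e) ^ (Multiplicative.toAdd g).val) (fun _ _ => pow_ne_zero _ hη0)
    (fun g h _ => by
      have h1 := pow_mod_orderOf (ζ ^ e)
        ((Multiplicative.toAdd g).val + (Multiplicative.toAdd h).val)
      rw [← hη.eq_orderOf] at h1
      rw [← pow_add, toAdd_mul, ZMod.val_add, h1])
  obtain ⟨s, hs⟩ := IsSepClosed.exists_pow_nat_eq (r ⟨⟩) e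
  have hr' : ∀ σ, ρ σ = 1 → σ (r ⟨⟩) = algebraMap K Ω ((ζ ^ e) ^ (z σ).val) * r ⟨⟩ :=
    fun σ hσ => hr ⟨σ, hσ⟩ ⟨⟩
  have hfixed : ∀ σ, ρ σ = 1 → σ (s ^ (d * e)) = s ^ (d * e) := by
    intro σ hσ
    rw [mul_comm, pow_mul, hs, map_pow, hr' σ hσ, mul_pow, ← map_pow, ← pow_mul, mul_comm _ d,
      pow_mul, hη.pow_eq_one, one_pow, map_one, one_mul]
  obtain ⟨l, l', hl', hl⟩ := M.exists_fraction _ hfixed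
  have hs0 : s ≠ 0 := by
    rintro rfl
    exact hr0 ⟨⟩ (by rw [← hs, zero_pow he0])
  obtain ⟨k, hk⟩ := IsKummerExponent.exists_of_pow_fixed hζ hn hs0 hfixed
  -- Multiplying the root by the denominator of its `n`-th power brings that power into `R`.
  have hpow : (s * M.emb l') ^ (d * e) = M.emb (l * l' ^ (d * e - 1)) := by
    rw [mul_pow, map_mul, ← hl, map_pow, mul_assoc, ← pow_succ',
      Nat.sub_add_cancel (Nat.one_le_iff_ne_zero.2 hn)]
  have hne' : s * M.emb l' ≠ 0 := mul_ne_zero hs0 (M.emb_ne_zero hl')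
  refine ⟨s * M.emb l', l * l' ^ (d * e - 1), k, hne', ?_, hpow, fun σ hσ => ?_, fun σ hσ => ?_⟩
  · intro h
    rw [h, map_zero] at hpow
    exact pow_ne_zero _ hne' hpow
  · rw [map_mul, hk σ hσ, M.apply_emb_of_eq_one hσ, mul_assoc]
  · have h1 := hr' σ hσ
    rw [← hs, map_pow, hk σ hσ, mul_pow] at h1
    have h2 := mul_right_cancel₀ (pow_ne_zero e hs0) h1
    have h3 : (ζ ^ e) ^ k σ = (ζ ^ e) ^ ((z σ).val : ℤ) := by
      apply (algebraMap K Ω).injective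
      rw [zpow_natCast, ← h2, map_zpow₀, map_pow, ← zpow_natCast, ← zpow_natCast, zpow_comm]
    have h4 : (d : ℤ) ∣ k σ - (z σ).val := by
      rw [← hη.zpow_eq_one_iff_dvd, zpow_sub₀ hη0, h3, div_self (zpow_ne_zero _ hη0)]
    rw [← ZMod.intCast_zmod_eq_zero_iff_dvd, Int.cast_sub, Int.cast_natCast, ZMod.natCast_val,
      ZMod.cast_id, sub_eq_zero] at h4
    exact h4

end FractionModel

/-! ### Divisors of Kummer homomorphisms -/

lemma multiplicity_finset_prod_pow {R J : Type*} [CommRing R] [IsDomain R] [WfDvdMonoid R] {p : R}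
    (hp : Prime p) (D : Finset J) (f : J → R) (hf : ∀ j ∈ D, f j ≠ 0) (e : J → ℕ) :
    multiplicity p (∏ j ∈ D, f j ^ e j) = ∑ j ∈ D, e j * multiplicity p (f j) := by
  classical
  induction D using Finset.induction_on with
  | empty => simpa using multiplicity_of_one_right hp.not_isUnit
  | insert j D hj ih =>
    have h1 : ∀ i ∈ insert j D, f i ^ e i ≠ 0 := fun i hi => pow_ne_zero _ (hf i hi)
    rw [Finset.sum_insert hj, ← ih fun i hi => hf i (Finset.mem_insert_of_mem hi),
      Finset.prod_insert hj, multiplicity_mul hp, FiniteMultiplicity.multiplicity_pow hp]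
    · exact FiniteMultiplicity.of_prime_left hp (hf j (Finset.mem_insert_self _ _))
    · rw [← Finset.prod_insert (f := fun i => f i ^ e i) hj]
      exact FiniteMultiplicity.of_prime_left hp (Finset.prod_ne_zero_iff.2 h1)

namespace FractionModel

variable {K Ω : Type*} [Field K] [Field Ω] [Algebra K Ω] {H : Type*} [Group H]
  {ρ : Gal(Ω/K) →* H} {R : Type*} [CommRing R] [IsDomain R] (M : FractionModel ρ R)
  {A : Type*} [AddCommGroup A] (π : Representation ℤ H A)

/-- If the Kummer homomorphism `∑ j, k j • b j` attached to elements `l j` of `R` is equivariant,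
then so is its divisor, the function `p ↦ ∑ j, v_p(l j) • b j` on the primes of `R`. It suffices
to test this on the coordinates of `A`, where it says that the divisor of an `n`-th power is
divisible by `n`. -/
lemma sum_multiplicity_act [UniqueFactorizationMonoid R] {n : ℕ} {ζ : K}
    (hζ : IsPrimitiveRoot ζ n) (hn : n ≠ 0)
    (hρ : Function.Surjective ρ) {y : Gal(Ω/K) → A}
    (hy : ∀ τ σ, ρ σ = 1 → y (τ * σ * τ⁻¹) = π (ρ τ) (y σ))
    {J : Type*} [Fintype J] {d : J → ℕ} {b : J → A} {x : ∀ j, A →+ ZMod (d j)}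
    (hd : ∀ j, d j ∣ n) (hx : ∀ a, a = ∑ j, (x j a).val • b j)
    {s : J → Ω} {l : J → R} {k : J → Gal(Ω/K) → ℤ} (hs0 : ∀ j, s j ≠ 0) (hl0 : ∀ j, l j ≠ 0)
    (hs : ∀ j, s j ^ n = M.emb (l j)) (hk : ∀ j, IsKummerExponent ρ ζ (s j) (k j))
    (hky : ∀ σ, ρ σ = 1 → y σ = ∑ j, k j σ • b j) {p : R} (hp : Prime p) (h : H) :
    ∑ j, multiplicity (M.act h p) (l j) • b j = π h (∑ j, multiplicity p (l j) • b j) := by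
  have hext : ∀ a a' : A, (∀ i, x i a = x i a') → a = a' := fun a a' h => by
    rw [hx a, hx a']
    simp only [h]
  refine hext _ _ fun i => ?_
  obtain ⟨e, he⟩ := hd i
  have he0 : e ≠ 0 := by rintro rfl; exact hn (by rw [he, mul_zero])
  have hdi : NeZero (d i) := ⟨by intro h; exact hn (by rw [he, h, zero_mul])⟩
  obtain ⟨τ, rfl⟩ := hρ h
  have hζ0 : ζ ≠ 0 := hζ.ne_zero hn
  have hζ0' : algebraMap K Ω ζ ≠ 0 := (map_ne_zero _).2 hζ0
  let X : J → ℕ := fun j => (x i (b j)).val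
  let X' : J → ℕ := fun j => (x i (π (ρ τ) (b j))).val
  have hX : ∀ j, (X j : ZMod (d i)) = x i (b j) := fun j => by
    simp only [X, ZMod.natCast_val, ZMod.cast_id]
  have hX' : ∀ j, (X' j : ZMod (d i)) = x i (π (ρ τ) (b j)) := fun j => by
    simp only [X', ZMod.natCast_val, ZMod.cast_id]
  -- The equivariance of `y` at `τ`, in the `i`-th coordinate, says that the Kummer exponents of the
  -- `n`-th roots `P` and `P'` agree modulo `n`, so that `P / P'` is a fraction of elements of `R`.
  let P : Ω := ∏ j, (τ⁻¹ (s j)) ^ (e * X j)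
  let P' : Ω := ∏ j, (s j) ^ (e * X' j)
  have hP : IsKummerExponent ρ ζ P _ :=
    IsKummerExponent.prod hζ0 _ fun j _ => ((hk j).conj τ).pow (e * X j)
  have hP' : IsKummerExponent ρ ζ P' _ :=
    IsKummerExponent.prod hζ0 _ fun j _ => (hk j).pow (e * X' j)
  have hP0' : P' ≠ 0 := Finset.prod_ne_zero_iff.2 fun j _ => pow_ne_zero _ (hs0 j)
  have hfix : ∀ σ, ρ σ = 1 → σ (P / P') = P / P' := by
    intro σ hσ
    have h1 : (d i : ℤ) ∣ ∑ j, X j * k j (τ * σ * τ⁻¹) - ∑ j, X' j * k j σ := by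
      rw [← ZMod.intCast_zmod_eq_zero_iff_dvd]
      push_cast
      have h2 := congrArg (x i) (hy τ σ hσ)
      rw [hky σ hσ, hky (τ * σ * τ⁻¹) (by simp [hσ])] at h2
      simp only [map_sum, map_zsmul, zsmul_eq_mul] at h2
      simp only [hX, hX', sub_eq_zero, mul_comm (x i _)]
      exact h2
    obtain ⟨w, hw⟩ := h1
    have h3 : ∑ j, ((e * X j : ℕ) : ℤ) * k j (τ * σ * τ⁻¹) =
        n * w + ∑ j, ((e * X' j : ℕ) : ℤ) * k j σ := by
      push_cast
      simp only [mul_assoc (e : ℤ), ← Finset.mul_sum]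
      rw [he]
      push_cast
      linear_combination (e : ℤ) * hw
    have hne := zpow_ne_zero (∑ j, ((e * X' j : ℕ) : ℤ) * k j σ) hζ0'
    rw [map_div₀, hP σ hσ, hP' σ hσ, h3, zpow_add₀ hζ0', zpow_mul, zpow_natCast, ← map_pow,
      hζ.pow_eq_one, map_one, one_zpow, one_mul]
    exact mul_div_mul_left _ _ hne
  obtain ⟨r, r', hr', hr⟩ := M.exists_fraction _ hfix
  have hemb : ∀ j, (τ⁻¹ (s j)) ^ n = M.emb (M.act (ρ τ)⁻¹ (l j)) := fun j => by
    rw [← map_pow, hs, M.equivariant, map_inv]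
  have hring : (∏ j, (M.act (ρ τ)⁻¹ (l j)) ^ (e * X j)) * r' ^ n =
      (∏ j, (l j) ^ (e * X' j)) * r ^ n := by
    apply M.emb_injective
    have h1 : P * M.emb r' = P' * M.emb r := by
      rw [← hr, ← mul_assoc, mul_div_cancel₀ _ hP0']
    have h2 := congrArg (· ^ n) h1
    simp only [P, P', mul_pow, ← Finset.prod_pow, pow_right_comm _ _ n, hs, hemb] at h2
    simpa only [map_mul, map_prod, map_pow] using h2
  have hact0 : ∀ j, M.act (ρ τ)⁻¹ (l j) ≠ 0 := fun j => by simpa using hl0 j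
  have hprod0 : ∏ j, (M.act (ρ τ)⁻¹ (l j)) ^ (e * X j) ≠ 0 :=
    Finset.prod_ne_zero_iff.2 fun j _ => pow_ne_zero _ (hact0 j)
  have hprod0' : ∏ j, (l j) ^ (e * X' j) ≠ 0 :=
    Finset.prod_ne_zero_iff.2 fun j _ => pow_ne_zero _ (hl0 j)
  have hr0 : r ≠ 0 := by
    rintro rfl
    rw [zero_pow hn, mul_zero] at hring
    exact mul_ne_zero hprod0 (pow_ne_zero n hr') hring
  have hval := congrArg (multiplicity p) hring
  have hfin : ∀ {z : R}, z ≠ 0 → FiniteMultiplicity p z := FiniteMultiplicity.of_prime_left hp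
  rw [multiplicity_mul hp (hfin (mul_ne_zero hprod0 (pow_ne_zero n hr'))),
    multiplicity_mul hp (hfin (mul_ne_zero hprod0' (pow_ne_zero n hr0))),
    FiniteMultiplicity.multiplicity_pow hp (hfin hr'),
    FiniteMultiplicity.multiplicity_pow hp (hfin hr0),
    multiplicity_finset_prod_pow hp _ _ (fun j _ => hact0 j),
    multiplicity_finset_prod_pow hp _ _ (fun j _ => hl0 j)] at hval
  have hmult : ∀ j, multiplicity p (M.act (ρ τ)⁻¹ (l j)) = multiplicity (M.act (ρ τ) p) (l j) := by
    intro j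
    rw [← multiplicity_map_eq (M.act (ρ τ)), ← RingAut.mul_apply, ← map_mul, mul_inv_cancel,
      map_one, RingAut.one_apply]
  simp only [hmult, mul_assoc, ← Finset.mul_sum] at hval
  rw [he, mul_assoc, mul_assoc, mul_left_comm, mul_left_comm (d i), ← mul_add, ← mul_add] at hval
  have hval' := congrArg (Nat.cast (R := ZMod (d i))) (Nat.eq_of_mul_eq_mul_left
    (Nat.pos_of_ne_zero he0) hval)
  push_cast at hval'
  simp only [hX, hX', CharP.cast_eq_zero, zero_mul, add_zero, mul_comm (x i _)] at hval'
  simpa only [map_sum, map_nsmul, nsmul_eq_mul] using hval'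

end FractionModel

/-- Congruent integers act in the same way on an element of finite order. -/
lemma zsmul_eq_of_dvd_sub {A : Type*} [AddCommGroup A] {n : ℕ} {i j : ℤ}
    (h : (n : ℤ) ∣ i - j) {a : A} (ha : n • a = 0) :
    i • a = j • a := by
  obtain ⟨w, hw⟩ := h
  rw [← sub_eq_zero, ← sub_smul, hw, mul_comm, mul_smul, natCast_zsmul, ha, smul_zero]

namespace FractionModel

variable {K Ω : Type*} [Field K] [Field Ω] [Algebra K Ω] {H : Type*} [Group H]
  {ρ : Gal(Ω/K) →* H} {R : Type*} [CommRing R] [IsDomain R] (M : FractionModel ρ R)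
  {A : Type*} [AddCommGroup A] (π : Representation ℤ H A)

/-- An equivariant homomorphism `y : ker ρ → A` has the form `∑ a, κ(q a) • a` where `κ(q)` is the
Kummer exponent of an `n`-th root of `q`, for a family `q` of elements of `R` which is equivariant
up to units. The element `q a` is the product of the primes at which the divisor of `y` is `a`. -/
theorem exists_equivariant_kummer_family [IsGalois K Ω] [IsSepClosed Ω]
    [UniqueFactorizationMonoid R] [Fintype A] {n : ℕ} {ζ : K}
    (hζ : IsPrimitiveRoot ζ n) (hn : n ≠ 0) (hA : ∀ a : A, n • a = 0)
    (hρ : Function.Surjective ρ) (hopen : IsOpen (ρ.ker : Set Gal(Ω/K))) {y : Gal(Ω/K) → A}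
    (hyloc : IsLocallyConstant y)
    (hadd : ∀ σ τ, ρ σ = 1 → ρ τ = 1 → y (σ * τ) = y σ + y τ)
    (hy : ∀ τ σ, ρ σ = 1 → y (τ * σ * τ⁻¹) = π (ρ τ) (y σ)) :
    ∃ q : A → R, (∀ a, q a ≠ 0) ∧ (∀ h a, Associated (M.act h (q a)) (q (π h a))) ∧
      ∀ (s : A → Ω) (k : A → Gal(Ω/K) → ℤ),
        (∀ a, ∃ l, Associated (q a) l ∧ s a ^ n = M.emb l) →
        (∀ a, IsKummerExponent ρ ζ (s a) (k a)) →
        ∀ σ, ρ σ = 1 → y σ = ∑ a, k a σ • a := by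
  classical
  obtain ⟨J, hJ, d, b, x, hd, hx⟩ := exists_generators_coordinates hA
  have hex := fun j => M.exists_kummer_lift hζ hn (hd j).2.1 hopen (hyloc.comp (x j))
    (fun σ τ hσ hτ => by simp only [Function.comp_apply, hadd σ τ hσ hτ, map_add])
  choose s l k hs0 hl0 hs hk hkx using hex
  have hky : ∀ σ, ρ σ = 1 → y σ = ∑ j, k j σ • b j := by
    intro σ hσ
    conv_lhs => rw [hx (y σ)]
    refine Finset.sum_congr rfl fun j _ => ?_
    have := NeZero.mk (hd j).1
    rw [← natCast_zsmul]
    refine zsmul_eq_of_dvd_sub ?_ (hd j).2.2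
    rw [← ZMod.intCast_zmod_eq_zero_iff_dvd, Int.cast_sub, Int.cast_natCast, ZMod.natCast_val,
      ZMod.cast_id, hkx j σ hσ, sub_eq_zero]
    rfl
  let : StrongNormalizationMonoid R := UniqueFactorizationMonoid.strongNormalizationMonoid
  let α : R → A := fun p => ∑ j, multiplicity p (l j) • b j
  have hαact : ∀ {p} h, Prime p → α (M.act h p) = π h (α p) := fun h hp =>
    M.sum_multiplicity_act π hζ hn hρ hy (fun j => (hd j).2.1) hx hs0 hl0 hs hk hky hp h
  have hαassoc : ∀ {p p'}, Associated p p' → α p = α p' := fun h =>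
    Finset.sum_congr rfl fun j _ => by rw [multiplicity_eq_of_associated_left h]
  let D : Finset R := Finset.univ.biUnion fun j =>
    (UniqueFactorizationMonoid.normalizedFactors (l j)).toFinset
  have hDprime : ∀ p ∈ D, Prime p ∧ normalize p = p := by
    intro p hp
    obtain ⟨j, -, hj⟩ := Finset.mem_biUnion.1 hp
    rw [Multiset.mem_toFinset] at hj
    exact ⟨UniqueFactorizationMonoid.prime_of_normalized_factor p hj,
      UniqueFactorizationMonoid.normalize_normalized_factor p hj⟩
  have hmemD : ∀ {p}, Prime p → normalize p = p → α p ≠ 0 → p ∈ D := by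
    intro p hp hnorm h0
    obtain ⟨j, -, hj⟩ := Finset.exists_ne_zero_of_sum_ne_zero h0
    have h1 : multiplicity p (l j) ≠ 0 := fun h => hj (by rw [h, zero_smul])
    rw [UniqueFactorizationMonoid.multiplicity_eq_count_normalizedFactors hp.irreducible (hl0 j),
      hnorm, Multiset.count_ne_zero] at h1
    exact Finset.mem_biUnion.2 ⟨j, Finset.mem_univ _, Multiset.mem_toFinset.2 h1⟩
  -- There may be infinitely many primes with `α p = 0`, but `a = 0` contributes nothing to the sum,
  -- so the empty product is taken there.
  let E : A → Finset R := fun a => if a = 0 then ∅ else D.filter fun p => α p = a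
  have hmemE : ∀ {p a}, p ∈ E a ↔ (a ≠ 0 ∧ Prime p ∧ normalize p = p ∧ α p = a) := by
    intro p a
    by_cases ha : a = 0
    · simp [E, ha]
    · simp only [E, if_neg ha, Finset.mem_filter]
      constructor
      · rintro ⟨h1, h2⟩
        exact ⟨ha, (hDprime p h1).1, (hDprime p h1).2, h2⟩
      · rintro ⟨-, h1, h2, h3⟩
        exact ⟨hmemD h1 h2 (h3 ▸ ha), h3⟩
  have hactE : ∀ {p a} h, p ∈ E a → normalize (M.act h p) ∈ E (π h a) := by
    intro p a h hp
    obtain ⟨h1, h2, h3, h4⟩ := hmemE.1 hp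
    have h5 : Prime (M.act h p) := (MulEquiv.prime_iff (M.act h)).2 h2
    refine hmemE.2 ⟨fun h0 => h1 ?_, (associated_normalize _).prime h5, normalize_idem _, ?_⟩
    · rw [← π.inv_self_apply h a, h0, map_zero]
    · rw [← hαassoc (associated_normalize _), hαact h h2, h4]
  have hactact : ∀ {p a} h, p ∈ E a → normalize (M.act h⁻¹ (normalize (M.act h p))) = p := by
    intro p a h hp
    obtain ⟨h1, h2, h3, h4⟩ := hmemE.1 hp
    conv_rhs => rw [← h3]
    refine normalize_eq_normalize_iff_associated.2 ?_
    have h5 := ((associated_normalize (M.act h p)).map (M.act h⁻¹)).symm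
    rwa [← RingAut.mul_apply, ← map_mul, inv_mul_cancel, map_one, RingAut.one_apply] at h5
  refine ⟨fun a => ∏ p ∈ E a, p, fun a => Finset.prod_ne_zero_iff.2 fun p hp =>
    (hmemE.1 hp).2.1.ne_zero, fun h a => ?_, fun s' k' hs' hk' σ hσ => ?_⟩
  · have h1 : ∏ p ∈ E (π h a), p = ∏ p ∈ E a, normalize (M.act h p) := by
      symm
      refine Finset.prod_nbij' (fun p => normalize (M.act h p)) (fun p => normalize (M.act h⁻¹ p))
        (fun p hp => hactE h hp) (fun p hp => ?_) (fun p hp => hactact h hp) (fun p hp => ?_)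
        (fun _ _ => rfl)
      · have h2 := hactE h⁻¹ hp
        rwa [π.inv_self_apply] at h2
      · have h2 := hactact h⁻¹ hp
        rwa [inv_inv] at h2
    beta_reduce
    rw [h1, map_prod]
    exact Associated.prod _ _ _ fun p _ => associated_normalize _
  · have hD0 : ∀ p : D, (p : R) ≠ 0 := fun p => (hDprime p p.2).1.ne_zero
    choose t κ ht0 ht hκ using fun p : D => M.exists_isKummerExponent hζ hn (hD0 p)
    have hζ0 := hζ.ne_zero hn
    have h1 : ∀ j, k j σ • b j = ∑ p : D, κ p σ • multiplicity (p : R) (l j) • b j := by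
      intro j
      have hprod : (UniqueFactorizationMonoid.normalizedFactors (l j)).prod =
          ∏ p : D, (p : R) ^ multiplicity (p : R) (l j) := by
        rw [Finset.prod_coe_sort D fun p => p ^ multiplicity p (l j),
          Finset.prod_multiset_count_of_subset _ D
            (Finset.subset_biUnion_of_mem (fun j =>
              (UniqueFactorizationMonoid.normalizedFactors (l j)).toFinset) (Finset.mem_univ j))]
        refine Finset.prod_congr rfl fun p hp => ?_
        rw [UniqueFactorizationMonoid.multiplicity_eq_count_normalizedFactors
          (hDprime p hp).1.irreducible (hl0 j), (hDprime p hp).2]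
      have h2 : IsKummerExponent ρ ζ (s j) fun σ =>
          ∑ p : D, (multiplicity (p : R) (l j) : ℤ) * κ p σ := by
        refine M.isKummerExponent_of_associated hζ hn
          (t := ∏ p : D, t p ^ multiplicity (p : R) (l j))
          (Finset.prod_ne_zero_iff.2 fun p _ => pow_ne_zero _ (ht0 p))
          (IsKummerExponent.prod hζ0 _ fun p _ => (hκ p).pow _)
          (UniqueFactorizationMonoid.prod_normalizedFactors (hl0 j)) (hs j) ?_
        rw [hprod, map_prod, ← Finset.prod_pow]
        refine Finset.prod_congr rfl fun p _ => ?_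
        rw [pow_right_comm, ht, map_pow]
      rw [zsmul_eq_of_dvd_sub ((hk j).dvd_sub hζ hn (hs0 j) h2 hσ) (hA _), Finset.sum_smul]
      refine Finset.sum_congr rfl fun p _ => ?_
      rw [mul_comm, mul_smul, natCast_zsmul]
    have h2 : y σ = ∑ p : D, κ p σ • α p := by
      rw [hky σ hσ, Finset.sum_congr rfl fun j _ => h1 j, Finset.sum_comm]
      refine Finset.sum_congr rfl fun p _ => ?_
      rw [Finset.smul_sum]
    rw [h2, ← Finset.sum_fiberwise (s := Finset.univ) (g := fun p : D => α p)]
    refine Finset.sum_congr rfl fun a _ => ?_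
    rcases eq_or_ne a 0 with rfl | ha
    · rw [smul_zero]
      refine Finset.sum_eq_zero fun p hp => ?_
      rw [(Finset.mem_filter.1 hp).2, smul_zero]
    · obtain ⟨l', hl', hsl'⟩ := hs' a
      have h3 : ∏ p ∈ Finset.univ.filter (fun p : D => α p = a), (p : R) = ∏ p ∈ E a, p := by
        refine (Finset.prod_map _ (Function.Embedding.subtype (· ∈ D))
          (fun p : R => p)).symm.trans ?_
        refine Finset.prod_congr ?_ fun _ _ => rfl
        ext p
        simp only [E, if_neg ha, Finset.mem_map, Finset.mem_filter, Finset.mem_univ, true_and,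
          Function.Embedding.subtype_apply]
        constructor
        · rintro ⟨p, hp, rfl⟩
          exact ⟨p.2, hp⟩
        · rintro ⟨hp, hp'⟩
          exact ⟨⟨p, hp⟩, hp', rfl⟩
      have h4 : IsKummerExponent ρ ζ (s' a) fun σ =>
          ∑ p ∈ Finset.univ.filter (fun p : D => α p = a), κ p σ := by
        refine M.isKummerExponent_of_associated hζ hn
          (t := ∏ p ∈ Finset.univ.filter (fun p : D => α p = a), t p)
          (Finset.prod_ne_zero_iff.2 fun p _ => ht0 p)
          (IsKummerExponent.prod hζ0 _ fun p _ => hκ p) hl' hsl' ?_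
        beta_reduce
        rw [← Finset.prod_pow, ← h3, map_prod]
        exact Finset.prod_congr rfl fun p _ => ht p
      have hs0' : s' a ≠ 0 := by
        intro h0
        rw [h0, zero_pow hn] at hsl'
        refine M.emb_ne_zero (hl'.ne_zero_iff.1 ?_) hsl'.symm
        exact Finset.prod_ne_zero_iff.2 fun p hp => (hmemE.1 hp).2.1.ne_zero
      rw [zsmul_eq_of_dvd_sub ((hk' a).dvd_sub hζ hn hs0' h4 hσ) (hA _), Finset.sum_smul]
      refine Finset.sum_congr rfl fun p hp => ?_
      rw [(Finset.mem_filter.1 hp).2]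

end FractionModel

/-! ### Descent of a splitting to the finite group -/

section Descent

variable {H : Type*} [Group H] [TopologicalSpace H]
  {A : Type*} [AddCommGroup A] (π : Representation ℤ H A)

lemma Z2.apply_one_left (f : Z2 π) (h : H) : f.1 (1, h) = f.1 (1, 1) := by
  have h1 := f.2.2 1 1 h
  simp only [mul_one, one_mul, map_one, Module.End.one_apply] at h1
  exact (add_left_cancel h1).symm

lemma Z2.apply_one_right (f : Z2 π) (g : H) : f.1 (g, 1) = π g (f.1 (1, 1)) := by
  have h1 := f.2.2 g 1 1
  simp only [mul_one] at h1
  exact add_right_cancel h1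

variable {Γ : Type*} [Group Γ] {ρ : Γ →* H} (f : Z2 π) {x : Γ → A}
  (hx : ∀ σ τ, f.1 (ρ σ, ρ τ) = π (ρ σ) (x τ) - x (σ * τ) + x σ)

include hx

lemma splitting_one : x 1 = f.1 (1, 1) := by
  have h1 := hx 1 1
  simp only [mul_one, map_one, Module.End.one_apply, sub_self, zero_add] at h1
  exact h1.symm

lemma splitting_mul_of_eq_one {σ : Γ} (hσ : ρ σ = 1) (τ : Γ) :
    x (σ * τ) = x σ + x τ - x 1 := by
  have h1 := hx σ τ
  rw [hσ, Z2.apply_one_left, map_one, Module.End.one_apply, ← splitting_one π f hx] at h1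
  rw [h1]
  abel

lemma splitting_conj {σ : Γ} (hσ : ρ σ = 1) (τ : Γ) :
    x (τ * σ * τ⁻¹) - x 1 = π (ρ τ) (x σ - x 1) := by
  have h1 := hx τ σ
  have h2 := splitting_mul_of_eq_one π f hx (σ := τ * σ * τ⁻¹) (by simp [hσ]) τ
  rw [inv_mul_cancel_right] at h2
  rw [hσ, Z2.apply_one_right, ← splitting_one π f hx, h2] at h1
  rw [map_sub, h1]
  abel

/-- A splitting of the pullback of a cocycle which is constant on the kernel descends. -/
lemma mem_B2_of_splitting [DiscreteTopology H] (hρ : Function.Surjective ρ)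
    (hN : ∀ σ, ρ σ = 1 → x σ = x 1) :
    (f : H × H → A) ∈ B2 π := by
  have hdesc : ∀ τ τ', ρ τ = ρ τ' → x τ = x τ' := by
    intro τ τ' h
    have h1 : ρ (τ * τ'⁻¹) = 1 := by rw [map_mul, map_inv, h, mul_inv_cancel]
    have h2 := splitting_mul_of_eq_one π f hx h1 τ'
    rw [inv_mul_cancel_right, hN _ h1] at h2
    rw [h2]
    abel
  choose T hT using hρ
  refine ⟨fun h => x (T h), IsLocallyConstant.of_discrete _, fun g h => ?_⟩
  have h1 := hx (T g) (T h)
  rw [hT, hT, hdesc (T g * T h) (T (g * h)) (by rw [map_mul, hT, hT, hT])] at h1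
  exact h1

end Descent

section Orbits

variable {H : Type*} [Group H] {A : Type*} [AddCommGroup A] (π : Representation ℤ H A)

lemma apply_out_mk (a : A) (h : H) : π (h : H ⧸ centralizer π a).out a = π h a := by
  have h1 : (h : H ⧸ centralizer π a).out⁻¹ * h ∈ centralizer π a := by
    rw [← QuotientGroup.eq, QuotientGroup.out_eq']
  have h2 : π ((h : H ⧸ centralizer π a).out⁻¹ * h) a = a := h1
  refine (congrArg (π (h : H ⧸ centralizer π a).out) h2).symm.trans ?_
  rw [← Module.End.mul_apply, ← map_mul, mul_inv_cancel_left]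

/-- The equivalence relation on `A` whose classes are the orbits of `H`. -/
def orbitSetoid : Setoid A where
  r a a' := ∃ h, π h a = a'
  iseqv := ⟨fun a => ⟨1, by simp⟩, by
    rintro _ _ ⟨h, rfl⟩
    exact ⟨h⁻¹, π.inv_self_apply h _⟩, by
    rintro _ _ _ ⟨h, rfl⟩ ⟨g, rfl⟩
    exact ⟨g * h, by rw [map_mul, Module.End.mul_apply]⟩⟩

/-- The elements of `A` are the translates of the representatives of the orbits, each indexed by
the cosets of its centralizer. -/
lemma bijective_orbit_translates : Function.Bijective
    fun p : (Σ o : Quotient (orbitSetoid π), H ⧸ centralizer π o.out) => π p.2.out p.1.out := by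
  constructor
  · rintro ⟨o, c⟩ ⟨o', c'⟩ h
    change π c.out o.out = π c'.out o'.out at h
    have h1 : o = o' := by
      rw [← o.out_eq, ← o'.out_eq]
      refine Quotient.sound ⟨c'.out⁻¹ * c.out, ?_⟩
      rw [map_mul, Module.End.mul_apply, h, π.inv_self_apply]
    subst h1
    refine congrArg _ ?_
    rw [← QuotientGroup.out_eq' c, ← QuotientGroup.out_eq' c']
    refine QuotientGroup.eq.2 ?_
    change π (c.out⁻¹ * c'.out) o.out = o.out
    rw [map_mul, Module.End.mul_apply, ← h, π.inv_self_apply]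
  · intro a
    obtain ⟨h, hh⟩ := Quotient.mk_out (s := orbitSetoid π) a
    exact ⟨⟨Quotient.mk (orbitSetoid π) a, (h : H ⧸ _)⟩, (apply_out_mk π _ h).trans hh⟩

end Orbits

section Main

attribute [local instance] Subgroup.fintypeQuotientOfFiniteIndex

variable {K Ω : Type*} [Field K] [Field Ω] [Algebra K Ω] {H : Type*} [Group H] [Finite H]
  [TopologicalSpace H] [DiscreteTopology H]
  {ρ : Gal(Ω/K) →* H} {R : Type*} [CommRing R] [IsDomain R]
  {A : Type*} [AddCommGroup A] (π : Representation ℤ H A)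

/-- If the centralizer of `a` acts on `r` by units, then these units form a character with values
in the roots of unity. Its Bockstein `χ` is such that the pullback of `cor (a ∪ χ)` is split by the
cochain formed with the Kummer exponents of the translates of `r`. -/
lemma FractionModel.exists_splitting_cor_cup (M : FractionModel ρ R) [IsSepClosed Ω]
    {n m : ℕ} (hn : n ≠ 0) (hm : m ≠ 0)
    {ω : K} (hω : IsPrimitiveRoot ω (n * m)) (hH : ∀ h : H, h ^ m = 1) {a : A} (ha : n • a = 0)
    {r : R} (hr0 : r ≠ 0) (hr : ∀ h ∈ centralizer π a, Associated (M.act h r) r) :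
    ∃ (χ : Z2 (Representation.trivial ℤ (centralizer π a) ℤ))
      (W : Gal(Ω/K) → H ⧸ centralizer π a → ℤ) (s : H ⧸ centralizer π a → Ω),
      (∀ σ τ, (corZ2 (centralizer π a) π (cupZ2 _ (centralizedElt π a) χ)).1 (ρ σ, ρ τ) =
        -(π (ρ σ) (orbitCochain π a W τ) - orbitCochain π a W (σ * τ) + orbitCochain π a W σ)) ∧
      ∀ c, s c ^ n = M.emb (M.act c.out r) ∧
        IsKummerExponent ρ (ω ^ m) (s c) (fun σ => W σ c) := by
  have hnm : n * m ≠ 0 := mul_ne_zero hn hm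
  have : NeZero (n * m) := ⟨hnm⟩
  have : NeZero m := ⟨hm⟩
  have hωΩ := hω.map_of_injective (algebraMap K Ω).injective
  have hω0 : ω ≠ 0 := hω.ne_zero hnm
  have hne : NeZero ((n * m : ℕ) : Ω) := hωΩ.neZero'
  have : NeZero (n : Ω) := ⟨fun h => hne.out (by rw [Nat.cast_mul, h, zero_mul])⟩
  have hη : IsPrimitiveRoot (algebraMap K Ω ω ^ n) m := hωΩ.pow (Nat.pos_of_ne_zero hnm) rfl
  have hex : ∀ h : centralizer π a, ∃ u : Rˣ, M.act h r = u * r := fun h => by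
    obtain ⟨u, hu⟩ := (hr h h.2).symm
    exact ⟨u, by rw [← hu, mul_comm]⟩
  choose u hu using hex
  have hmul : ∀ g h, u (g * h) = u g * u h := by
    intro g h
    apply Units.ext
    apply mul_right_cancel₀ hr0
    rw [← hu, Subgroup.coe_mul, map_mul, RingAut.mul_apply, hu, map_mul, M.unit_fixed, hu,
      Units.val_mul]
    ring
  let φ : centralizer π a →* Rˣ := MonoidHom.mk' u hmul
  have hpow : ∀ h, u h ^ m = 1 := fun h => by
    change φ h ^ m = 1
    rw [← map_pow, show h ^ m = 1 from Subtype.ext (hH h), map_one]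
  have hV : ∀ h : centralizer π a, ∃ V : ℤ,
      M.emb (u h) = algebraMap K Ω (ω ^ (n * V)) ∧ (h = 1 → V = 0) := by
    intro h
    by_cases h1 : h = 1
    · exact ⟨0, by rw [h1, show u 1 = 1 from map_one φ]; simp, fun _ => rfl⟩
    · have h2 : M.emb (u h) ^ m = 1 := by
        rw [← map_pow, ← Units.val_pow_eq_pow_val, hpow, Units.val_one, map_one]
      obtain ⟨i, -, hi⟩ := hη.eq_pow_of_pow_eq_one h2
      exact ⟨i, by rw [← hi, zpow_mul, zpow_natCast, zpow_natCast, map_pow, map_pow],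
        fun h => absurd h h1⟩
  choose V hV hV1 using hV
  have hVdvd : ∀ g h, (m : ℤ) ∣ V h - V (g * h) + V g := by
    intro g h
    have h1 : M.emb (u (g * h)) = M.emb (u g) * M.emb (u h) := by
      rw [hmul, Units.val_mul, map_mul]
    rw [hV, hV, hV, ← map_mul] at h1
    have h2 := (algebraMap K Ω).injective h1
    have h3 : ω ^ (n * (V h - V (g * h) + V g)) = 1 := by
      rw [mul_add, mul_sub, zpow_add₀ hω0, zpow_sub₀ hω0, h2]
      have := zpow_ne_zero (n * V g) hω0
      have := zpow_ne_zero (n * V h) hω0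
      field_simp
    have h4 := (hω.zpow_eq_one_iff_dvd _).1 h3
    push_cast at h4
    exact Int.dvd_of_mul_dvd_mul_left (by exact_mod_cast hn) h4
  choose χ hχ using hVdvd
  have hm' : (m : ℤ) ≠ 0 := by exact_mod_cast hm
  have hχmem : (fun p : centralizer π a × centralizer π a => χ p.1 p.2) ∈
      Z2 (Representation.trivial ℤ (centralizer π a) ℤ) := by
    refine ⟨IsLocallyConstant.of_discrete _, fun g h j => ?_⟩
    change χ (g * h) j + χ g h = χ h j + χ g (h * j)
    apply mul_left_cancel₀ hm'
    rw [mul_add, mul_add, ← hχ, ← hχ, ← hχ, ← hχ, mul_assoc]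
    ring
  choose s hs using fun c : H ⧸ centralizer π a =>
    IsSepClosed.exists_pow_nat_eq (M.emb (M.act c.out r)) n
  have hs0 : ∀ c, s c ≠ 0 := fun c h => by
    have h1 := hs c
    rw [h, zero_pow hn] at h1
    exact M.emb_ne_zero (by simpa using hr0) h1.symm
  have hW : ∀ (τ : Gal(Ω/K)) c, ∃ W : ℤ, τ (s ((ρ τ)⁻¹ • c)) =
      algebraMap K Ω (ω ^ (V (transferElt _ c (ρ τ)) + m * W)) * s c := by
    intro τ c
    refine exists_eq_pow_mul_of_pow_eq hn hm hω (hs0 c) _ ?_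
    rw [← map_pow, hs, hs, M.equivariant, ← RingAut.mul_apply, ← map_mul,
      ← out_mul_transferElt, map_mul, RingAut.mul_apply, hu, map_mul, M.unit_fixed, map_mul, hV]
  choose W hW using hW
  refine ⟨⟨_, hχmem⟩, W, s, ?_, fun c => ⟨hs c, fun σ hσ => ?_⟩⟩
  · exact corZ2_cupZ2_eq_neg_coboundary π ρ a hm ha ⟨_, hχmem⟩ V (fun g h => (hχ g h).symm) W
      (dvd_exponent_cocycle ρ hnm hω s hs0 (fun τ c => V (transferElt _ c (ρ τ)) + m * W τ c) hW)
  · have h1 := hW σ c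
    rw [hσ, inv_one, one_smul, transferElt_one, hV1 1 rfl, zero_add, zpow_mul, map_zpow₀,
      zpow_natCast] at h1
    exact h1

/-- A class which vanishes in the cohomology of the Galois group of a field of the form considered
in `FractionModel` is a sum of corestrictions of cup products. -/
theorem FractionModel.mem_closure_of_splitting (M : FractionModel ρ R) [IsGalois K Ω]
    [IsSepClosed Ω] [UniqueFactorizationMonoid R] [Finite A] {n m : ℕ} (hn : n ≠ 0) (hm : m ≠ 0)
    {ω : K} (hω : IsPrimitiveRoot ω (n * m)) (hH : ∀ h : H, h ^ m = 1) (hA : ∀ a : A, n • a = 0)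
    (hρ : Function.Surjective ρ) (hopen : IsOpen (ρ.ker : Set Gal(Ω/K))) (f : Z2 π)
    {x : Gal(Ω/K) → A} (hxloc : IsLocallyConstant x)
    (hx : ∀ σ τ, f.1 (ρ σ, ρ τ) = π (ρ σ) (x τ) - x (σ * τ) + x σ) :
    (QuotientAddGroup.mk f : H2 π) ∈ AddSubgroup.closure {α : H2 π |
      ∃ (a : A) (χ : H2 (Representation.trivial ℤ (centralizer π a) ℤ)),
        α = cor (centralizer π a) π (cup _ (centralizedElt π a) χ)} := by
  classical
  have := Fintype.ofFinite A
  have hζ : IsPrimitiveRoot (ω ^ m) n :=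
    hω.pow (Nat.pos_of_ne_zero (mul_ne_zero hn hm)) (mul_comm _ _)
  obtain ⟨q, hq0, hqact, hq⟩ := M.exists_equivariant_kummer_family π hζ hn hA hρ hopen
    (y := fun σ => x σ - x 1) (hxloc.comp (· - x 1))
    (fun σ τ hσ _ => by rw [splitting_mul_of_eq_one π f hx hσ]; abel)
    (fun τ σ hσ => splitting_conj π f hx hσ τ)
  have hqS : ∀ a, ∀ h ∈ centralizer π a, Associated (M.act h (q a)) (q a) := fun a h hh => by
    have h1 := hqact h a
    rwa [show π h a = a from hh] at h1
  choose χ W s hχ hs using fun a =>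
    M.exists_splitting_cor_cup π hn hm hω hH (hA a) (hq0 a) (hqS a)
  let O := Quotient (orbitSetoid π)
  have : Fintype O := Fintype.ofFinite _
  let e := Equiv.ofBijective _ (bijective_orbit_translates π)
  have hsum : ∀ σ, ρ σ = 1 → x σ - x 1 = ∑ o : O, orbitCochain π o.out (W o.out) σ := by
    intro σ hσ
    have h1 : ∑ o : O, orbitCochain π o.out (W o.out) σ =
        ∑ p : (Σ o : O, H ⧸ centralizer π o.out), W p.1.out σ p.2 • e p := by
      rw [Fintype.sum_sigma]
      rfl
    rw [h1, ← e.symm.sum_comp]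
    simp only [e.apply_symm_apply]
    refine hq (fun a => s _ (e.symm a).2) (fun a σ => W _ σ (e.symm a).2)
      (fun a => ⟨M.act (e.symm a).2.out (q (e.symm a).1.out), ?_, (hs _ _).1⟩)
      (fun a => (hs _ _).2) σ hσ
    have h1 := hqact (e.symm a).2.out (e.symm a).1.out
    rw [show π (e.symm a).2.out (e.symm a).1.out = a from e.apply_symm_apply a] at h1
    exact h1.symm
  let z : O → Z2 π := fun o =>
    corZ2 (centralizer π o.out) π (cupZ2 _ (centralizedElt π o.out) (χ o.out))
  have hF : ((f + ∑ o, z o : Z2 π) : H × H → A) ∈ B2 π := by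
    refine mem_B2_of_splitting π (ρ := ρ) (f + ∑ o, z o)
      (x := fun σ => x σ - ∑ o : O, orbitCochain π o.out (W o.out) σ) (fun σ τ => ?_) hρ
      (fun σ hσ => ?_)
    · have h1 : ((f + ∑ o, z o : Z2 π) : H × H → A) (ρ σ, ρ τ) =
          f.1 (ρ σ, ρ τ) + ∑ o, (z o).1 (ρ σ, ρ τ) := by
        simp
      rw [h1, hx, Finset.sum_congr rfl fun o _ => hχ o.out σ τ]
      simp only [Finset.sum_neg_distrib, Finset.sum_add_distrib, Finset.sum_sub_distrib, map_sub,
        map_sum]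
      abel
    · rw [← hsum σ hσ, ← hsum 1 (map_one ρ)]
      abel
  have hF' : (QuotientAddGroup.mk f : H2 π) = -∑ o, (QuotientAddGroup.mk (z o) : H2 π) := by
    rw [eq_neg_iff_add_eq_zero]
    have h1 := (QuotientAddGroup.eq_zero_iff (N := (B2 π).addSubgroupOf (Z2 π)) (f + ∑ o, z o)).2 hF
    rw [← h1]
    exact (map_sum (QuotientAddGroup.mk' ((B2 π).addSubgroupOf (Z2 π))) z Finset.univ ▸ rfl)
  rw [hF']
  refine neg_mem (sum_mem fun o _ => AddSubgroup.subset_closure ⟨o.out, χ o.out, rfl⟩)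

end Main

/-! ### The rational function field -/

/-- The Galois group of a finite Galois extension `L` of `K` as a quotient of the absolute Galois
group of `K`, with an embedding of `L` in the separable closure. -/
lemma exists_galois_hom (K L : Type*) [Field K] [Field L] [Algebra K L] [FiniteDimensional K L]
    [IsGalois K L] :
    ∃ (ρ : Gal(SeparableClosure K/K) →* Gal(L/K)) (i : L →ₐ[K] SeparableClosure K),
      Function.Surjective ρ ∧ IsOpen {σ | ρ σ = 1} ∧ (∀ τ l, τ (i l) = i (ρ τ l)) ∧
        ∀ e, (∀ σ, ρ σ = 1 → σ e = e) → ∃ l, i l = e := by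
  let Ω := SeparableClosure K
  let i : L →ₐ[K] Ω := IsSepClosed.lift
  let : Algebra L Ω := i.toRingHom.toAlgebra
  have : IsScalarTower K L Ω := IsScalarTower.of_algebraMap_eq fun x => (i.commutes x).symm
  let ρ : Gal(Ω/K) →* Gal(L/K) := AlgEquiv.restrictNormalHom L
  have hequiv : ∀ (τ : Gal(Ω/K)) l, τ (i l) = i (ρ τ l) := fun τ l =>
    (AlgEquiv.restrictNormal_commutes τ L l).symm
  have hker : ∀ σ : Gal(Ω/K), ρ σ = 1 ↔ σ ∈ i.fieldRange.fixingSubgroup := by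
    intro σ
    rw [IntermediateField.mem_fixingSubgroup_iff]
    constructor
    · rintro h _ ⟨l, rfl⟩
      change σ (i l) = i l
      rw [hequiv, h, AlgEquiv.one_apply]
    · intro h
      ext l
      apply i.injective
      exact (hequiv σ l).symm.trans (h _ ⟨l, rfl⟩)
  have hkerset : {σ : Gal(Ω/K) | ρ σ = 1} = i.fieldRange.fixingSubgroup := Set.ext hker
  have hfin : FiniteDimensional K i.fieldRange :=
    LinearEquiv.finiteDimensional (AlgEquiv.ofInjectiveField i).toLinearEquiv
  refine ⟨ρ, i, AlgEquiv.restrictNormalHom_surjective Ω, ?_, hequiv, fun y hy => ?_⟩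
  · rw [hkerset]
    exact i.fieldRange.fixingSubgroup_isOpen
  · have h1 : y ∈ IntermediateField.fixedField i.fieldRange.fixingSubgroup :=
      fun σ => hy σ.1 ((hker _).2 σ.2)
    rw [InfiniteGalois.fixedField_fixingSubgroup] at h1
    exact h1

universe u

/-- The rational function field `k(X_h : h ∈ H)` over an algebraically closed field `k`, with `H`
permuting the variables, yields a `FractionModel` over its fixed field. -/
theorem exists_fractionModel (k : Type u) [Field k] [IsAlgClosed k] (H : Type*) [Group H]
    [Finite H] :
    ∃ (K : Type u) (_ : Field K) (_ : Algebra k K) (ρ : Gal(SeparableClosure K/K) →* H),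
      Function.Surjective ρ ∧ IsOpen {σ | ρ σ = 1} ∧
        Nonempty (FractionModel ρ (MvPolynomial (Fin (Nat.card H)) k)) := by
  let R := MvPolynomial (Fin (Nat.card H)) k
  let L := FractionRing R
  let perm : H →* Equiv.Perm (Fin (Nat.card H)) :=
    (Equiv.permCongrHom (Finite.equivFin H)).toMonoidHom.comp (MulAction.toPermHom H H)
  let act : H →* (R ≃+* R) :=
    { toFun := fun h => (MvPolynomial.renameEquiv k (perm h)).toRingEquiv
      map_one' := by
        refine RingEquiv.ext fun r => ?_
        change MvPolynomial.rename (perm 1) r = r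
        rw [map_one, Equiv.Perm.coe_one, MvPolynomial.rename_id_apply]
      map_mul' := fun g h => by
        refine RingEquiv.ext fun r => ?_
        change MvPolynomial.rename (perm (g * h)) r =
          MvPolynomial.rename (perm g) (MvPolynomial.rename (perm h) r)
        rw [map_mul, Equiv.Perm.coe_mul, MvPolynomial.rename_rename] }
  have hact : ∀ h r, act h r = MvPolynomial.rename (perm h) r := fun _ _ => rfl
  let : MulSemiringAction H R := MulSemiringAction.compHom R act
  let : MulSemiringAction H L := IsFractionRing.mulSemiringAction H R L
  have hsmul : ∀ (h : H) (r : R), h • algebraMap R L r = algebraMap R L (act h r) := by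
    intro h r
    exact IsFractionRing.ringEquivOfRingEquiv_algebraMap _ r
  have hfaithful : FaithfulSMul H L := ⟨fun {g h} hgh => by
    have h1 := hgh (algebraMap R L (MvPolynomial.X (Finite.equivFin H 1)))
    rw [hsmul, hsmul] at h1
    have h2 := IsFractionRing.injective R L h1
    rw [hact, hact, MvPolynomial.rename_X, MvPolynomial.rename_X] at h2
    have h3 := MvPolynomial.X_injective h2
    have h4 : ∀ g, perm g (Finite.equivFin H 1) = Finite.equivFin H g := fun g => by
      simp [perm, Equiv.permCongrHom]
    rw [h4, h4] at h3
    exact (Finite.equivFin H).injective h3⟩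
  obtain ⟨ρ, i, hρ, hopen, hequiv, hfix⟩ := exists_galois_hom (FixedPoints.subfield H L) L
  let e := FixedPoints.toAlgAutMulEquiv H L
  have he : ∀ (g : Gal(L/FixedPoints.subfield H L)) l, e.symm g • l = g l := fun g l => by
    change e (e.symm g) l = _
    rw [e.apply_symm_apply]
  let incl : k →+* FixedPoints.subfield H L :=
    ((algebraMap R L).comp MvPolynomial.C).codRestrict (FixedPoints.subfield H L) fun c h => by
      change h • algebraMap R L (MvPolynomial.C c) = algebraMap R L (MvPolynomial.C c)
      rw [hsmul, hact, MvPolynomial.rename_C]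
  refine ⟨FixedPoints.subfield H L, inferInstance, incl.toAlgebra, e.symm.toMonoidHom.comp ρ,
    e.symm.surjective.comp hρ, ?_, ⟨?_⟩⟩
  · convert hopen using 3
    exact map_eq_one_iff e.symm e.symm.injective
  exact
    { act := act
      emb := (i : L →+* _).comp (algebraMap R L)
      emb_injective := i.injective.comp (IsFractionRing.injective R L)
      equivariant := fun τ r => by
        have h1 := hsmul (e.symm (ρ τ)) r
        rw [he] at h1
        exact (hequiv τ _).trans (congrArg i h1)
      unit_fixed := fun h u => by
        obtain ⟨c, -, hc⟩ := MvPolynomial.isUnit_iff_eq_C_of_isReduced.1 u.isUnit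
        rw [hact, hc, MvPolynomial.rename_C]
      exists_unit_root := fun u n hn => by
        obtain ⟨c, hc, hu⟩ := MvPolynomial.isUnit_iff_eq_C_of_isReduced.1 u.isUnit
        obtain ⟨d, hd⟩ := IsAlgClosed.exists_pow_nat_eq c (Nat.pos_of_ne_zero hn)
        have hd' : IsUnit (MvPolynomial.C d : R) := by
          refine IsUnit.map MvPolynomial.C (isUnit_pow_iff hn |>.1 ?_)
          rwa [hd]
        refine ⟨hd'.unit, Units.ext ?_⟩
        rw [Units.val_pow_eq_pow_val, IsUnit.unit_spec, ← map_pow, hd, hu]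
      exists_fraction := fun y hy => by
        obtain ⟨l, rfl⟩ := hfix y fun σ hσ => hy σ ((congrArg e.symm hσ).trans (map_one _))
        obtain ⟨r, r', hr', rfl⟩ := IsFractionRing.div_surjective (A := R) l
        refine ⟨r, r', nonZeroDivisors.ne_zero hr', ?_⟩
        refine (map_mul i _ _).symm.trans (congrArg i (div_mul_cancel₀ _ ?_))
        exact (map_ne_zero_iff _ (IsFractionRing.injective R L)).2 (nonZeroDivisors.ne_zero hr') }

/-! ### The negligible classes -/

/-- A negligible class vanishes in particular over the fixed field of `H` in a rational function
field, and is therefore a sum of corestrictions of cup products. -/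
theorem mem_closure_of_mem_negligible {H : Type*} [Group H] [Finite H] [TopologicalSpace H]
    [DiscreteTopology H] {A : Type*} [AddCommGroup A] [Finite A] (π : Representation ℤ H A)
    {F : Type*} [Field F] {n m : ℕ} (hA : ∀ a : A, n • a = 0) (hH : ∀ h : H, h ^ m = 1)
    (hn : n ≠ 0) (hm : m ≠ 0) {ω : F} (hω : IsPrimitiveRoot ω (n * m)) {α : H2 π}
    (hα : α ∈ negligible F π) :
    α ∈ AddSubgroup.closure {α : H2 π |
      ∃ (a : A) (χ : H2 (Representation.trivial ℤ (centralizer π a) ℤ)),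
        α = cor (centralizer π a) π (cup _ (centralizedElt π a) χ)} := by
  obtain ⟨f, rfl⟩ := QuotientAddGroup.mk_surjective α
  obtain ⟨K, _, _, ρ, hρ, hopen, ⟨M⟩⟩ := exists_fractionModel (AlgebraicClosure F) H
  let incl : F →+* K :=
    (algebraMap (AlgebraicClosure F) K).comp (algebraMap F (AlgebraicClosure F))
  let : Algebra F K := incl.toAlgebra
  have hcont : Continuous ρ := by
    refine continuous_of_continuousAt_one ρ ?_
    rw [ContinuousAt, map_one, nhds_discrete H, Filter.tendsto_pure]
    exact hopen.mem_nhds (map_one ρ)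
  have h1 := hα K ⟨ρ, hcont⟩
  obtain ⟨x, hxloc, hx⟩ := (QuotientAddGroup.eq_zero_iff _).1 h1
  exact M.mem_closure_of_splitting π hn hm (hω.map_of_injective incl.injective) hH hA hρ hopen f
    hxloc hx

end NegligibleCohomology

theorem mainTheorem2
    {H : Type*} [Group H] [Finite H] [TopologicalSpace H] [DiscreteTopology H]
    {A : Type*} [AddCommGroup A] [Finite A] (π : Representation ℤ H A)
    (F : Type*) [Field F]
    (hF : ∃ ζ : F, IsPrimitiveRoot ζ (AddMonoid.exponent A * Monoid.exponent H)) :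
    NegligibleCohomology.negligible F π =
      AddSubgroup.closure
        {α : NegligibleCohomology.H2 π |
          ∃ (a : A) (χ : NegligibleCohomology.H2
              (Representation.trivial ℤ (NegligibleCohomology.centralizer π a) ℤ)),
            α = NegligibleCohomology.cor (NegligibleCohomology.centralizer π a) π
              (NegligibleCohomology.cup (π.comp (NegligibleCohomology.centralizer π a).subtype)
                (NegligibleCohomology.centralizedElt π a) χ)} := by
  obtain ⟨ω, hω⟩ := hF
  have hA : ∀ a : A, AddMonoid.exponent A • a = 0 := AddMonoid.exponent_nsmul_eq_zero
  have hH : ∀ h : H, h ^ Monoid.exponent H = 1 := Monoid.pow_exponent_eq_one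
  have hn : AddMonoid.exponent A ≠ 0 := AddMonoid.exponent_ne_zero_of_finite
  have hm : Monoid.exponent H ≠ 0 := Monoid.exponent_ne_zero_of_finite
  apply le_antisymm
  · exact fun α hα =>
      NegligibleCohomology.mem_closure_of_mem_negligible π hA hH hn hm hω hα
  · rw [AddSubgroup.closure_le]
    rintro _ ⟨a, χ, rfl⟩
    exact NegligibleCohomology.cor_cup_mem_negligible π hA hH hn hm hω a χ
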